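/- A promise problem is a pair $A=(A_{\rm yes},A_{\rm no})$ of disjoint sets of binary strings; it is \emph{totally decidable} if some deterministic Turing machine (single tape, tape alphabet $\{0,1,\square\}$) outputs $1$ on every $x\in A_{\rm yes}$, $0$ on every $x\in A_{\rm no}$ and $10$ on all other $x\in\{0,1\}^*$. A \emph{BQP-machine} is a deterministic Turing machine of polynomial runtime whose output on each $x\in\{0,1\}^*$ is read as the code of a quantum circuit over the gates $H$, $T$, $\mathrm{CNOT}$; write $U_x$ for its unitary and $k$ for its number of qubits. A \emph{QCMA-} or \emph{QMA-machine} is the same, except that on input $x$ the machine also outputs the number $m=m(|x|)$ of witness qubits, where $m$ is a polynomially bounded function that can be computed in polynomial time; the circuit then acts on the $m$ witness qubits followed by $k$ ancilla qubits. An output that is not the code of a circuit stands for a trivial circuit that never accepts. Let $\Pi_{\rm acc}=|1\rangle\langle 1|$ on the first qubit and, for a unit vector $|\psi\rangle\in\mathbb{C}^{2^m}$ (with $m=0$ and no $\psi$ for BQP), $$p_x(\psi)=(\langle\psi|\otimes\langle 0^k|)\,U_x^\dagger\Pi_{\rm acc}U_x\,(|\psi\rangle\otimes|0^k\rangle).$$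 The machine \emph{decides} a promise problem $A$ if - (BQP) $p_x\ge 2/3$ for all $x\in A_{\rm yes}$, and $p_x\le 1/3$ for all $x\in A_{\rm no}$; - (QCMA) for all $x\in A_{\rm yes}$ there is $y\in\{0,1\}^m$ with $p_x(|y\rangle)\ge 2/3$, and for all $x\in A_{\rm no}$ and all $y\in\{0,1\}^m$ one has $p_x(|y\rangle)\le 1/3$; - (QMA) for all $x\in A_{\rm yes}$ there is a unit vector $|\psi\rangle\in\mathbb{C}^{2^m}$ with $p_x(\psi)\ge 2/3$, and for all $x\in A_{\rm no}$ and all unit vectors $|\psi\rangle\in\mathbb{C}^{2^m}$ one has $p_x(\psi)\le 1/3$. The \emph{extremal problem} of a machine is the promise problem that it decides and of which every other promise problem $B$ that it decides is a subproblem ($B_{\rm yes}\subseteq A_{\rm yes}$, $B_{\rm no}\subseteq A_{\rm no}$). \textbf{Lemma.} Every BQP-, QCMA- and QMA-machine has an extremal problem $A$, and $A$ is totally decidable. Moreover $A_{\rm yes}=\{x: P_{\rm acc}(x)\ge 2/3\}$ and $A_{\rm no}=\{x: P_{\rm acc}(x)\le 1/3\}$, where $P_{\rm acc}(x)=p_x$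 for BQP, $P_{\rm acc}(x)=\max_{y\in\{0,1\}^m}p_x(|y\rangle)$ for QCMA, and $P_{\rm acc}(x)$ is the largest eigenvalue of the operator $Q_x=\langle 0^k|U_x^\dagger\Pi_{\rm acc}U_x|0^k\rangle$ on the witness qubits for QMA. Thus a deterministic Turing machine decides whether $P_{\rm acc}(x)$ is $\le 1/3$, $\ge 2/3$, or strictly in between. -/

import Mathlib

open Turing

/-! ### Deterministic Turing machines over the tape alphabet `{0, 1, □}` -/

namespace TotalDec

/-- Head movements: left, right, neutral. -/
inductive HeadMove where
  | L
  | R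
  | N

/-- A deterministic single-tape Turing machine. Tape symbols are `some false = 0`, `some true = 1`
and the blank `none`. The transition function is never consulted in a final state. -/
structure DTM where
  S : Type
  [finS : Fintype S]
  init : S
  final : S → Bool
  δ : S → Option Bool → S × Option Bool × HeadMove

/-- Moving the head. -/
def moveHead : HeadMove → Tape (Option Bool) → Tape (Option Bool)
  | HeadMove.L, T => T.move Dir.left
  | HeadMove.R, T => T.move Dir.right
  | HeadMove.N, T => T

namespace DTM

/-- A configuration: current state and tape (with head position). -/
structure Cfg (M : DTM) where
  state : M.S
  tape : Tape (Option Bool)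

/-- The input is written on an otherwise blank tape, the head is on its first symbol. -/
def start (M : DTM) (x : List Bool) : M.Cfg :=
  ⟨M.init, Tape.mk₁ (x.map some)⟩

/-- One computational step; nothing changes any more once a final state is reached. -/
def step (M : DTM) (c : M.Cfg) : M.Cfg :=
  match M.final c.state with
  | true => c
  | false =>
    let r := M.δ c.state c.tape.head
    ⟨r.1, moveHead r.2.2 (c.tape.write r.2.1)⟩

/-- The configuration after `t` steps on input `x`. -/
def run (M : DTM) (x : List Bool) (t : ℕ) : M.Cfg :=
  M.step^[t] (M.start x)

/-- `M` has halted on input `x` after at most `t` steps. -/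
def HaltsWithin (M : DTM) (x : List Bool) (t : ℕ) : Prop :=
  M.final (M.run x t).state = true

/-- The string written between the head position and the next blank symbol is `w`. -/
def TapeReads (T : Tape (Option Bool)) (w : List Bool) : Prop :=
  ∀ i : ℕ, i ≤ w.length → T.nth (i : ℤ) = w[i]?

/-- `M(x) = w`: on input `x` the machine halts and outputs `w`. -/
def Outputs (M : DTM) (x w : List Bool) : Prop :=
  ∃ t : ℕ, M.HaltsWithin x t ∧ TapeReads (M.run x t).tape w

/-- `M` has polynomial runtime (on all inputs). -/
def PolyTime (M : DTM) : Prop :=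
  ∃ p : Polynomial ℕ, ∀ x : List Bool, M.HaltsWithin x (p.eval x.length)

end DTM

/-- Binary representation without leading zeros, most significant bit first. -/
def bin (n : ℕ) : List Bool :=
  if n = 0 then [false] else n.bits.reverse

/-- The set `poly`: polynomially bounded functions `f` such that some polynomial-time DTM outputs
`bin (f n)` on every input of length `n`. -/
def IsPoly (f : ℕ → ℕ) : Prop :=
  (∃ p : Polynomial ℕ, ∀ n, f n ≤ p.eval n) ∧
    ∃ M : DTM, M.PolyTime ∧ ∀ x : List Bool, M.Outputs x (bin (f x.length))

/-! ### Promise problems -/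

/-- A promise problem over binary strings. -/
@[ext] structure PromiseProblem where
  yes : Set (List Bool)
  no : Set (List Bool)
  disj : Disjoint yes no

/-- `A ≤ B` iff `A` is a subproblem of `B`. -/
instance : PartialOrder PromiseProblem where
  le A B := A.yes ⊆ B.yes ∧ A.no ⊆ B.no
  le_refl _ := ⟨subset_rfl, subset_rfl⟩
  le_trans _ _ _ h h' := ⟨h.1.trans h'.1, h.2.trans h'.2⟩
  le_antisymm _ _ h h' := PromiseProblem.ext (h.1.antisymm h'.1) (h.2.antisymm h'.2)

/-- Some DTM outputs `1` on yes-instances, `0` on no-instances and `10` on all other strings. -/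
def TotallyDecidable (A : PromiseProblem) : Prop :=
  ∃ M : DTM, (∀ x ∈ A.yes, M.Outputs x [true]) ∧ (∀ x ∈ A.no, M.Outputs x [false]) ∧
    ∀ x, x ∉ A.yes ∪ A.no → M.Outputs x [true, false]

/-- `A` is the extremal problem of a machine that decides exactly the problems `B` with
`decides B`: the machine decides `A`, and every problem it decides is a subproblem of `A`. -/
def IsExtremalProblem (decides : PromiseProblem → Prop) (A : PromiseProblem) : Prop :=
  IsGreatest {B | decides B} A

/-! ### Quantum circuits over `H`, `T`, `CNOT` -/

/-- Gates; qubits are numbered from `0`. `CNOT c t` has control `c` and target `t`. -/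
inductive Gate where
  | H (q : ℕ)
  | T (q : ℕ)
  | CNOT (c t : ℕ)

namespace Gate

/-- A gate is well-formed unless it is a `CNOT` whose control equals its target. -/
def WellFormed : Gate → Prop
  | H _ => True
  | T _ => True
  | CNOT c t => c ≠ t

/-- The number of qubits needed to apply the gate. -/
def width : Gate → ℕ
  | H q => q + 1
  | T q => q + 1
  | CNOT c t => max (c + 1) (t + 1)

/-- The code word of a gate: gate type (`01`, `10` or `11`), then the qubits in unary, the first
qubit being `1`; separated by `0`. -/
def encode : Gate → List Bool
  | H q => [false, true, false] ++ List.replicate (q + 1) true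
  | T q => [true, false, false] ++ List.replicate (q + 1) true
  | CNOT c t =>
    [true, true, false] ++ List.replicate (c + 1) true ++ [false] ++ List.replicate (t + 1) true

end Gate

/-- The code word of a circuit: its gates in the order of application, separated by `0`. -/
def encodeCircuit (C : List Gate) : List Bool :=
  [false].intercalate (C.map Gate.encode)

/-- Empty, or starting with the separator `0`. -/
def Tail (r : List Bool) : Prop := r = [] ∨ ∃ s, r = false :: s

theorem Tail.replicate_inj : ∀ (a b : ℕ) (r s : List Bool), Tail r → Tail s →
    List.replicate a true ++ r = List.replicate b true ++ s → a = b ∧ r = s := by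
  intro a
  induction a with
  | zero =>
    intro b r s hr hs h
    cases b with
    | zero => simpa using h
    | succ b =>
      rcases hr with rfl | ⟨r, rfl⟩ <;> simp [List.replicate_succ] at h
  | succ a ih =>
    intro b r s hr hs h
    cases b with
    | zero => rcases hs with rfl | ⟨s, rfl⟩ <;> simp [List.replicate_succ] at h
    | succ b =>
      simp only [List.replicate_succ, List.cons_append, List.cons.injEq, true_and] at h
      obtain ⟨h1, h2⟩ := ih b r s hr hs h
      exact ⟨by rw [h1], h2⟩

theorem Gate.encode_append_inj (g h : Gate) (r s : List Bool) (hr : Tail r) (hs : Tail s)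
    (e : g.encode ++ r = h.encode ++ s) : g = h ∧ r = s := by
  cases g <;> cases h <;> simp only [Gate.encode, List.append_assoc, List.cons_append,
    List.nil_append, List.cons.injEq, Bool.false_eq_true, Bool.true_eq_false, false_and,
    true_and, and_false] at e
  · obtain ⟨h1, h2⟩ := Tail.replicate_inj _ _ _ _ hr hs e
    exact ⟨by rw [Nat.succ_injective h1], h2⟩
  · obtain ⟨h1, h2⟩ := Tail.replicate_inj _ _ _ _ hr hs e
    exact ⟨by rw [Nat.succ_injective h1], h2⟩
  · obtain ⟨h1, h2⟩ := Tail.replicate_inj _ _ _ _ (Or.inr ⟨_, rfl⟩) (Or.inr ⟨_, rfl⟩) e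
    simp only [List.cons.injEq, true_and] at h2
    obtain ⟨h3, h4⟩ := Tail.replicate_inj _ _ _ _ hr hs h2
    exact ⟨by rw [Nat.succ_injective h1, Nat.succ_injective h3], h4⟩

/-- A string is the code word of at most one circuit. -/
theorem encodeCircuit_inj (C C' : List Gate) (h : encodeCircuit C = encodeCircuit C') : C = C' := by
  have key : ∀ (g : Gate) (C : List Gate), ∃ r, Tail r ∧ encodeCircuit (g :: C) = g.encode ++ r ∧
      r = (if C = [] then [] else false :: encodeCircuit C) := by
    intro g C
    cases C with
    | nil => exact ⟨[], Or.inl rfl, by simp [encodeCircuit], by simp⟩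
    | cons h C => exact ⟨false :: encodeCircuit (h :: C), Or.inr ⟨_, rfl⟩,
        by simp [encodeCircuit, List.intercalate], by simp⟩
  have ne : ∀ g C, encodeCircuit (g :: C) ≠ [] := by
    intro g C
    obtain ⟨r, _, e, _⟩ := key g C
    rw [e]; cases g <;> simp [Gate.encode]
  induction C generalizing C' with
  | nil => cases C' with
    | nil => rfl
    | cons g C' => exact absurd h.symm (ne g C')
  | cons g C ih =>
    cases C' with
    | nil => exact absurd h (ne g C)
    | cons g' C' =>
      obtain ⟨r, hr, e, er⟩ := key g C
      obtain ⟨r', hr', e', er'⟩ := key g' C'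
      rw [e, e'] at h
      obtain ⟨rfl, h2⟩ := Gate.encode_append_inj _ _ _ _ hr hr' h
      rw [er, er'] at h2
      split_ifs at h2 with h3 h4 h4
      · rw [h3, h4]
      · rw [ih _ (List.cons.inj h2).2]

/-- `w` is the code word of the circuit `C`. -/
def IsCodeOf (w : List Bool) (C : List Gate) : Prop :=
  (∀ g ∈ C, g.WellFormed) ∧ encodeCircuit C = w

open Classical in
/-- The circuit with code word `w`, or `none` if `w` is not a code word. -/
noncomputable def decodeCircuit (w : List Bool) : Option (List Gate) :=
  if h : ∃ C, IsCodeOf w C then some h.choose else none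

theorem decodeCircuit_encodeCircuit (C : List Gate) (h : ∀ g ∈ C, g.WellFormed) :
    decodeCircuit (encodeCircuit C) = some C := by
  have hh : ∃ C', IsCodeOf (encodeCircuit C) C' := ⟨C, h, rfl⟩
  rw [decodeCircuit, dif_pos hh]
  exact congrArg some (encodeCircuit_inj _ _ hh.choose_spec.2)

/-- Computational basis states of `n` qubits. -/
abbrev Basis (n : ℕ) : Type := Fin n → Fin 2

/-- Operators on `n` qubits, in the computational basis. -/
abbrev Op (n : ℕ) : Type := Matrix (Basis n) (Basis n) ℂ

/-- The value of qubit `q` in a basis state (only used for `q < n`). -/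
def bit {n : ℕ} (a : Basis n) (q : ℕ) : Fin 2 :=
  if h : q < n then a ⟨q, h⟩ else 0

/-- Hadamard gate. -/
noncomputable def hMat : Matrix (Fin 2) (Fin 2) ℂ :=
  (1 / ((Real.sqrt 2 : ℝ) : ℂ)) • !![1, 1; 1, -1]

/-- T-gate. -/
noncomputable def tMat : Matrix (Fin 2) (Fin 2) ℂ :=
  !![1, 0; 0, Complex.exp (Complex.I * ((Real.pi / 4 : ℝ) : ℂ))]

/-- Controlled NOT on (control, target): `|c, t⟩ ↦ |c, c ⊕ t⟩`. -/
def cnotMat : Matrix (Fin 2 × Fin 2) (Fin 2 × Fin 2) ℂ :=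
  Matrix.of fun a b => if a.1 = b.1 ∧ a.2 = b.1 + b.2 then 1 else 0

/-- A one-qubit operator applied to qubit `q`, the identity on all other qubits. -/
def onQubit (n : ℕ) (G : Matrix (Fin 2) (Fin 2) ℂ) (q : ℕ) : Op n :=
  Matrix.of fun a b =>
    if ∀ j : Fin n, (j : ℕ) ≠ q → a j = b j then G (bit a q) (bit b q) else 0

/-- A two-qubit operator applied to the qubits `c` and `t`, the identity on all others. -/
def onQubits (n : ℕ) (G : Matrix (Fin 2 × Fin 2) (Fin 2 × Fin 2) ℂ) (c t : ℕ) : Op n :=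
  Matrix.of fun a b =>
    if ∀ j : Fin n, (j : ℕ) ≠ c → (j : ℕ) ≠ t → a j = b j then
      G (bit a c, bit a t) (bit b c, bit b t) else 0

/-- The unitary of a gate on `n` qubits. -/
noncomputable def Gate.op (n : ℕ) : Gate → Op n
  | Gate.H q => onQubit n hMat q
  | Gate.T q => onQubit n tMat q
  | Gate.CNOT c t => onQubits n cnotMat c t

/-- The unitary `U_l ⋯ U_1` of the circuit `[U_1, …, U_l]`. -/
noncomputable def circuitOp (n : ℕ) (C : List Gate) : Op n :=
  C.foldl (fun U g => g.op n * U) 1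

/-- The projector `|1⟩⟨1|` on the output qubit, which is the first one. -/
def accProj (n : ℕ) : Op n :=
  Matrix.diagonal fun a => if bit a 0 = 1 then 1 else 0

/-- The number `k` of ancilla qubits of a circuit with `m` witness qubits. The witness qubits are
the first `m` ones, and the ancillas are the further qubits that occur in the circuit or serve as
the output qubit. -/
def ancillas (m : ℕ) (C : List Gate) : ℕ :=
  (C.map Gate.width).foldr max 1 - m

/-- The vector `|ψ⟩ ⊗ |0^k⟩` on `m + k` qubits. -/
def withZeros {m : ℕ} (k : ℕ) (ψ : Basis m → ℂ) : Basis (m + k) → ℂ :=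
  fun a => if ∀ j : Fin k, a (Fin.natAdd m j) = 0 then ψ fun i => a (Fin.castAdd k i) else 0

open scoped Matrix in
/-- `(⟨ψ| ⊗ ⟨0^k|) U† Π_acc U (|ψ⟩ ⊗ |0^k⟩)` for the circuit with code word `w`. A string that is
not a code word stands for a trivial circuit that never accepts. -/
noncomputable def accProb {m : ℕ} (w : List Bool) (ψ : Basis m → ℂ) : ℝ :=
  match decodeCircuit w with
  | none => 0
  | some C =>
    let k := ancillas m C
    let U := circuitOp (m + k) C
    (star (withZeros k ψ) ⬝ᵥ ((Uᴴ * accProj (m + k) * U) *ᵥ withZeros k ψ)).re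

open scoped Matrix in
/-- The operator `Q = ⟨0^k| U† Π_acc U |0^k⟩` on the `m` witness qubits. -/
noncomputable def accOp (m : ℕ) (w : List Bool) : Op m :=
  match decodeCircuit w with
  | none => 0
  | some C =>
    let k := ancillas m C
    let U := circuitOp (m + k) C
    (Uᴴ * accProj (m + k) * U).submatrix (fun y => Fin.append y 0) (fun y => Fin.append y 0)

/-- The computational basis vector `|y⟩`. -/
def ket {m : ℕ} (y : Basis m) : Basis m → ℂ := Pi.single y 1

/-! ### BQP-, QCMA- and QMA-machines -/

/-- A BQP-machine: a DTM of polynomial runtime; its output `code x` on input `x` is read as the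
code word of a circuit. -/
structure BQPMachine where
  M : DTM
  polyTime : M.PolyTime
  code : List Bool → List Bool
  outputs : ∀ x, M.Outputs x (code x)

/-- The acceptance probability `⟨0^k| U_x† Π_acc U_x |0^k⟩`. -/
noncomputable def BQPMachine.pAcc (V : BQPMachine) (x : List Bool) : ℝ :=
  accProb (m := 0) (V.code x) (ket 0)

/-- `V` decides `A` as a BQP-machine. -/
def BQPMachine.Decides (V : BQPMachine) (A : PromiseProblem) : Prop :=
  (∀ x ∈ A.yes, 2 / 3 ≤ V.pAcc x) ∧ ∀ x ∈ A.no, V.pAcc x ≤ 1 / 3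

/-- A QCMA- or QMA-machine: a DTM of polynomial runtime that on every input `x` outputs the
number `m |x|` of witness qubits (in unary, closed by a `0`), followed by a string `code x` that is
read as the code word of a circuit; `m` is in `poly`. -/
structure VerifierMachine where
  M : DTM
  polyTime : M.PolyTime
  m : ℕ → ℕ
  isPoly : IsPoly m
  code : List Bool → List Bool
  outputs : ∀ x, M.Outputs x (List.replicate (m x.length) true ++ false :: code x)

/-- The acceptance probability on input `x` with witness state `ψ`. -/
noncomputable def VerifierMachine.pAcc (V : VerifierMachine) (x : List Bool)
    (ψ : Basis (V.m x.length) → ℂ) : ℝ :=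
  accProb (V.code x) ψ

/-- `V` decides `A` as a QCMA-machine: witnesses are classical strings. -/
def VerifierMachine.QCMADecides (V : VerifierMachine) (A : PromiseProblem) : Prop :=
  (∀ x ∈ A.yes, ∃ y : Basis (V.m x.length), 2 / 3 ≤ V.pAcc x (ket y)) ∧
    ∀ x ∈ A.no, ∀ y : Basis (V.m x.length), V.pAcc x (ket y) ≤ 1 / 3

/-- `ψ` is a unit vector. -/
def IsState {m : ℕ} (ψ : Basis m → ℂ) : Prop :=
  ∑ a, ‖ψ a‖ ^ 2 = 1

/-- `V` decides `A` as a QMA-machine: witnesses are quantum states. -/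
def VerifierMachine.QMADecides (V : VerifierMachine) (A : PromiseProblem) : Prop :=
  (∀ x ∈ A.yes, ∃ ψ : Basis (V.m x.length) → ℂ, IsState ψ ∧ 2 / 3 ≤ V.pAcc x ψ) ∧
    ∀ x ∈ A.no, ∀ ψ : Basis (V.m x.length) → ℂ, IsState ψ → V.pAcc x ψ ≤ 1 / 3

/-- The operator `Q_x = ⟨0^k| U_x† Π_acc U_x |0^k⟩` on the witness qubits. -/
noncomputable def VerifierMachine.Q (V : VerifierMachine) (x : List Bool) :
    Op (V.m x.length) :=
  accOp (V.m x.length) (V.code x)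

/-- `A` consists of the `x` with `P x ≥ 2/3` (yes) and those with `P x ≤ 1/3` (no), so that
`1/3 < P x < 2/3` on the remaining strings. -/
def IsThresholdProblem (P : List Bool → ℝ) (A : PromiseProblem) : Prop :=
  A.yes = {x | 2 / 3 ≤ P x} ∧ A.no = {x | P x ≤ 1 / 3}

end TotalDec

/-!
# Extremal problems of BQP-, QCMA- and QMA-machines

In each of the three cases, the machine decides a promise problem `B` if and only if its acceptance
probability `P` satisfies `2/3 ≤ P x` on the yes-instances and `P x ≤ 1/3` on the no-instances of
`B`. For QCMA this holds for the maximum over classical witnesses, and for QMA for the largest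
eigenvalue of the acceptance operator, which is the maximum of its quadratic form on unit vectors
(`accProb_le_maxEigenvalue`, `exists_isState_accProb_eq`). Hence the threshold problem of `P` is the
extremal one (`exists_extremalProblem`). BQP is the case of QCMA without witness qubits.

What remains is that a Turing machine can compare `P x` with `1/3` and `2/3`. The comparison is shown
to be primitive recursive in `x`, and primitive recursive functions are shown to be computable by
machines of the required kind.

*Simulation.* A machine of polynomial runtime can be run for the number of steps given by its
polynomial, so its output is a primitive recursive function of the input (`DTM.PolyTime.primrec`).
Code words of circuits are recognized and decoded by primitive recursive functions (`parse`,
`IsCircuitWord`).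

*Exact arithmetic.* The entries of the gates, multiplied by `√2`, lie in `ℤ[ζ]` for `ζ = exp (iπ/4)`.
A circuit of `l` gates thus has an acceptance operator `Q` for which `2 ^ l Q` has entries in `ℤ[ζ]`,
and these are computed by sums over computational basis states (`val_accEntry`). The real part of an
element of `ℤ[ζ]` is `a + b / √2` with integers `a`, `b`, so its sign can be found by comparing
integers (`nonnegAt_iff`, `posAt_iff`).

*Thresholds.* For classical witnesses, the diagonal entries of `c - 3 Q` are to be compared with `0`.
For quantum witnesses, no eigenvalue is computed: the polynomial `det (X + c - 3 Q)` has only real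
roots, namely `3 λ - c` for the eigenvalues `λ` of `Q`, and the roots of such a polynomial are all
nonpositive (negative) if and only if its coefficients are all nonnegative (positive); see
`forall_nonpos_iff`, `forall_neg_iff`. The coefficients are computed by the Leibniz formula
(`det_eq_sum_map`, `val_charSum`).

*Turing machines.* The tape holds two unary counters, separated by a binary word that is initially
the input with a leading `1` (`counterTape`). Registers are stored in one counter as exponents of primes, the other one
serving for multiplication and division, and primitive recursive functions are compiled to programs
on registers (`Frag.exists_computes`, `exists_DTM_of_primrec`).
-/

namespace TotalDec

/-! ### Fragments of Turing machines and their composition -/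

/-- The two-sided tapes of the machines considered here. -/
abbrev BTape : Type := Tape (Option Bool)

/-- A fragment of a Turing machine: a transition table whose transitions may leave the fragment
through an exit in `E`. The exit carries a value, so that control flow can depend on it (`Frag.bind`);
in contrast to a machine, the initial state is never an exit, so a fragment makes at least one
transition. -/
structure Frag (E : Type) where
  S : Type
  [finS : Fintype S]
  init : S
  δ : S → Option Bool → (S ⊕ E) × Option Bool × HeadMove

attribute [instance] Frag.finS

namespace Frag

variable {E E' : Type}

/-- A single transition of a fragment. -/
inductive Step (F : Frag E) : (F.S ⊕ E) × BTape → (F.S ⊕ E) × BTape → Prop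
  | mk (s : F.S) (T : BTape) : Step F (Sum.inl s, T)
      ((F.δ s T.head).1, moveHead (F.δ s T.head).2.2 (T.write (F.δ s T.head).2.1))

/-- Started on the tape `T`, the fragment leaves through the exit `e` with the tape `T'`. -/
def Evals (F : Frag E) (T : BTape) (e : E) (T' : BTape) : Prop :=
  Relation.ReflTransGen F.Step (Sum.inl F.init, T) (Sum.inr e, T')

/-- The fragment that makes a single transition. -/
def act (f : Option Bool → E × Option Bool × HeadMove) : Frag E where
  S := Unit
  init := ()
  δ _ a := (Sum.inr (f a).1, (f a).2)

theorem act_evals (f : Option Bool → E × Option Bool × HeadMove) (T : BTape) :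
    (act f).Evals T (f T.head).1 (moveHead (f T.head).2.2 (T.write (f T.head).2.1)) :=
  Relation.ReflTransGen.single (Step.mk (F := act f) () T)

/-- Leave immediately through the exit `e`. -/
def pure (e : E) : Frag E := act fun a => (e, a, HeadMove.N)

theorem pure_evals (e : E) (T : BTape) : (pure e).Evals T e T := by
  have h := act_evals (fun a => (e, a, HeadMove.N)) T
  simp only [moveHead, Tape.write_self] at h
  exact h

/-- Sequential composition: continue with `G e` after leaving `F` through `e`. -/
def bind [Fintype E] (F : Frag E) (G : E → Frag E') : Frag E' where
  S := F.S ⊕ Σ e, (G e).S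
  init := Sum.inl F.init
  δ s a := match s with
    | Sum.inl s => (Sum.inl ((F.δ s a).1.elim Sum.inl fun e => Sum.inr ⟨e, (G e).init⟩), (F.δ s a).2)
    | Sum.inr ⟨e, s⟩ => (((G e).δ s a).1.elim (fun s => Sum.inl (Sum.inr ⟨e, s⟩)) Sum.inr,
        ((G e).δ s a).2)

theorem bind_evals [Fintype E] {F : Frag E} {G : E → Frag E'} {T T' T'' : BTape} {e : E} {e' : E'}
    (h : F.Evals T e T') (h' : (G e).Evals T' e' T'') : (F.bind G).Evals T e' T'' := by
  have h1 := h.lift (p := (F.bind G).Step) (fun c =>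
    (Sum.inl (c.1.elim Sum.inl fun e => Sum.inr ⟨e, (G e).init⟩), c.2)) (by
      rintro _ _ ⟨s, T⟩
      exact Step.mk (F := F.bind G) (Sum.inl s) T)
  have h2 := h'.lift (p := (F.bind G).Step) (fun c =>
    (c.1.elim (fun s => Sum.inl (Sum.inr ⟨e, s⟩)) Sum.inr, c.2)) (by
      rintro _ _ ⟨s, T⟩
      exact Step.mk (F := F.bind G) (Sum.inr ⟨e, s⟩) T)
  exact h1.trans h2

/-- Change the exits. -/
def map [Fintype E] (f : E → E') (F : Frag E) : Frag E' := F.bind fun e => pure (f e)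

theorem map_evals [Fintype E] {f : E → E'} {F : Frag E} {T T' : BTape} {e : E}
    (h : F.Evals T e T') : (F.map f).Evals T (f e) T' :=
  bind_evals h (pure_evals _ _)

/-- Restart the fragment whenever it leaves through `none`. -/
def loop (F : Frag (Option E)) : Frag E where
  S := F.S
  init := F.init
  δ s a := ((F.δ s a).1.elim Sum.inl fun o => o.elim (Sum.inl F.init) Sum.inr, (F.δ s a).2)

theorem loop_lift (F : Frag (Option E)) {T T' : BTape} {o : Option E} (h : F.Evals T o T') :
    Relation.ReflTransGen F.loop.Step (Sum.inl F.loop.init, T)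
      (o.elim (Sum.inl F.loop.init) Sum.inr, T') :=
  h.lift (p := F.loop.Step) (fun c =>
    (c.1.elim Sum.inl fun o => o.elim (Sum.inl F.init) Sum.inr, c.2)) (by
      rintro _ _ ⟨s, T⟩
      exact Step.mk (F := F.loop) s T)

theorem loop_exit {F : Frag (Option E)} {T T' : BTape} {e : E} (h : F.Evals T (some e) T') :
    F.loop.Evals T e T' :=
  loop_lift F h

theorem loop_continue {F : Frag (Option E)} {T T' T'' : BTape} {e : E} (h : F.Evals T none T')
    (h' : F.loop.Evals T' e T'') : F.loop.Evals T e T'' :=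
  (loop_lift F h).trans h'

/-- The Turing machine that halts when the fragment is left. -/
def toDTM [Fintype E] (F : Frag E) : DTM where
  S := F.S ⊕ E
  init := Sum.inl F.init
  final := Sum.isRight
  δ s a := match s with
    | Sum.inl s => F.δ s a
    | Sum.inr e => (Sum.inr e, a, HeadMove.N)

theorem toDTM_outputs [Fintype E] {F : Frag E} {x w : List Bool} {e : E} {T : BTape}
    (h : F.Evals (Tape.mk₁ (x.map some)) e T) (hT : DTM.TapeReads T w) :
    F.toDTM.Outputs x w := by
  have key : ∀ c, Relation.ReflTransGen F.Step (Sum.inl F.init, Tape.mk₁ (x.map some)) c →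
      ∃ t, F.toDTM.run x t = ⟨c.1, c.2⟩ := by
    intro c hc
    induction hc with
    | refl => exact ⟨0, rfl⟩
    | tail _ hs ih =>
      obtain ⟨t, ht⟩ := ih
      refine ⟨t + 1, ?_⟩
      obtain ⟨s, T⟩ := hs
      simp only [DTM.run] at ht
      rw [DTM.run, Function.iterate_succ_apply', ht]
      rfl
  obtain ⟨t, ht⟩ := key _ h
  exact ⟨t, by simp only [DTM.HaltsWithin, ht]; rfl, by rw [ht]; exact hT⟩

end Frag

/-! ### A tape with two unary counters and a binary word -/

section Zipper

variable (a : Option Bool) (l r : List (Option Bool))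

theorem head_mk₂_cons : (Tape.mk₂ l (a :: r)).head = a := rfl

theorem write_mk₂_cons (b : Option Bool) :
    (Tape.mk₂ l (a :: r)).write b = Tape.mk₂ l (b :: r) := rfl

theorem move_right_mk₂_cons : moveHead .R (Tape.mk₂ l (a :: r)) = Tape.mk₂ (a :: l) r := by
  simp only [moveHead, Tape.mk₂, Tape.move_right_mk']; rfl

theorem move_left_mk₂_cons : moveHead .L (Tape.mk₂ (a :: l) r) = Tape.mk₂ l (a :: r) := by
  simp only [moveHead, Tape.mk₂, Tape.move_left_mk']; rfl

theorem move_left_mk₂_nil : moveHead .L (Tape.mk₂ [] r) = Tape.mk₂ [] (none :: r) := by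
  simp only [moveHead, Tape.mk₂, Tape.move_left_mk']; rfl

theorem mk₂_nil_right : Tape.mk₂ l [] = Tape.mk₂ l [none] := by
  have : (ListBlank.mk ([] : List (Option Bool))) = ListBlank.mk [none] :=
    Quotient.sound (Or.inl ⟨1, rfl⟩)
  simp only [Tape.mk₂, this]

theorem mk₂_nil_left : Tape.mk₂ [] r = Tape.mk₂ [none] r := by
  have : (ListBlank.mk ([] : List (Option Bool))) = ListBlank.mk [none] :=
    Quotient.sound (Or.inl ⟨1, rfl⟩)
  simp only [Tape.mk₂, this]

theorem mk₂_append_none : Tape.mk₂ l (r ++ [none]) = Tape.mk₂ l r := by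
  have : (ListBlank.mk (r ++ [none])) = ListBlank.mk r :=
    Quotient.sound (Or.inr ⟨1, rfl⟩)
  simp only [Tape.mk₂, this]

end Zipper

/-- The tape `1^a □ y □ 1^b` with the head on the first of the two separating blanks. -/
def counterTape (y : List Bool) (a b : ℕ) : BTape :=
  Tape.mk₂ (List.replicate a (some true))
    (none :: (y.map some ++ none :: List.replicate b (some true)))

namespace Frag

variable {E : Type}

theorem act_mk₂ {f : Option Bool → E × Option Bool × HeadMove} {l r : List (Option Bool)}
    {a b : Option Bool} {e : E} {d : HeadMove} (h : f a = (e, b, d)) {T : BTape}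
    (hT : moveHead d (Tape.mk₂ l (b :: r)) = T) :
    (act f).Evals (Tape.mk₂ l (a :: r)) e T := by
  have := act_evals f (Tape.mk₂ l (a :: r))
  rw [head_mk₂_cons, h, write_mk₂_cons] at this
  exact hT ▸ this

/-- Move, leaving the symbol unchanged. -/
def go (d : HeadMove) : Frag Unit := act fun a => ((), a, d)

/-- Write a symbol and move. -/
def put (b : Option Bool) (d : HeadMove) : Frag Unit := act fun _ => ((), b, d)

/-- Move until a blank is reached. -/
def scan (d : HeadMove) : Frag Unit :=
  loop (act fun a => match a with
    | none => (some (), none, HeadMove.N)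
    | some c => (none, some c, d))

theorem scan_right (w : List Bool) (l r : List (Option Bool)) :
    (scan .R).Evals (Tape.mk₂ l (w.map some ++ none :: r)) ()
      (Tape.mk₂ ((w.map some).reverse ++ l) (none :: r)) := by
  induction w generalizing l with
  | nil => exact loop_exit (act_mk₂ rfl rfl)
  | cons c w ih =>
    refine loop_continue (act_mk₂ rfl (move_right_mk₂_cons _ _ _)) ?_
    have h := ih (some c :: l)
    simp only [List.map_cons, List.reverse_cons, List.append_assoc, List.singleton_append] at h ⊢
    exact h

theorem scan_left (w : List Bool) (l r : List (Option Bool)) (c : Bool) :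
    (scan .L).Evals (Tape.mk₂ (w.map some ++ none :: l) (some c :: r)) ()
      (Tape.mk₂ l (none :: ((w.map some).reverse ++ some c :: r))) := by
  induction w generalizing c r with
  | nil =>
    refine loop_continue (act_mk₂ rfl (move_left_mk₂_cons _ _ _)) ?_
    exact loop_exit (act_mk₂ rfl rfl)
  | cons c' w ih =>
    refine loop_continue (act_mk₂ rfl (move_left_mk₂_cons _ _ _)) ?_
    have h := ih (some c :: r) c'
    simp only [List.map_cons, List.reverse_cons, List.append_assoc, List.singleton_append] at h ⊢
    exact h

/-- As `scan_left`, but for a word that starts left of the head. -/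
theorem go_scan_left (w : List Bool) (l r : List (Option Bool)) (a : Option Bool) :
    ((go .L).bind fun _ => scan .L).Evals (Tape.mk₂ (w.map some ++ none :: l) (a :: r)) ()
      (Tape.mk₂ l (none :: ((w.map some).reverse ++ a :: r))) := by
  cases w with
  | nil =>
    refine bind_evals (act_mk₂ rfl (move_left_mk₂_cons _ _ _)) ?_
    exact loop_exit (act_mk₂ rfl rfl)
  | cons c w =>
    refine bind_evals (act_mk₂ rfl (move_left_mk₂_cons _ _ _)) ?_
    simpa using scan_left w l (a :: r) c

theorem go_scan_left_end (w : List Bool) (r : List (Option Bool)) (a : Option Bool) :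
    ((go .L).bind fun _ => scan .L).Evals (Tape.mk₂ (w.map some) (a :: r)) ()
      (Tape.mk₂ [] (none :: ((w.map some).reverse ++ a :: r))) := by
  have h := go_scan_left w [] r a
  have e : Tape.mk₂ (w.map some ++ [none]) (a :: r) = Tape.mk₂ (w.map some) (a :: r) := by
    have : (ListBlank.mk (w.map some ++ [none])) = ListBlank.mk (w.map some) :=
      Quotient.sound (Or.inr ⟨1, rfl⟩)
    simp only [Tape.mk₂, this]
  rwa [e] at h

theorem go_scan_right (w : List Bool) (l r : List (Option Bool)) (a : Option Bool) :
    ((go .R).bind fun _ => scan .R).Evals (Tape.mk₂ l (a :: (w.map some ++ none :: r))) ()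
      (Tape.mk₂ ((w.map some).reverse ++ a :: l) (none :: r)) :=
  bind_evals (act_mk₂ rfl (move_right_mk₂_cons _ _ _)) (scan_right w _ r)

theorem go_scan_right_end (w : List Bool) (l : List (Option Bool)) (a : Option Bool) :
    ((go .R).bind fun _ => scan .R).Evals (Tape.mk₂ l (a :: w.map some)) ()
      (Tape.mk₂ ((w.map some).reverse ++ a :: l) [none]) := by
  have h := go_scan_right w l [] a
  rwa [show a :: (w.map some ++ [none]) = (a :: w.map some) ++ [none] from rfl,
    mk₂_append_none] at h

/-- Increment the left counter. -/
def incA : Frag Unit :=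
  ((go .L).bind fun _ => scan .L).bind fun _ => (put (some true) .R).bind fun _ => scan .R

theorem incA_evals (y : List Bool) (a b : ℕ) :
    incA.Evals (counterTape y a b) () (counterTape y (a + 1) b) := by
  have h := go_scan_left_end (List.replicate a true)
    (y.map some ++ none :: List.replicate b (some true)) none
  simp only [List.map_replicate, List.reverse_replicate] at h
  refine bind_evals h (bind_evals (act_mk₂ rfl (move_right_mk₂_cons _ _ _)) ?_)
  have h' := scan_right (List.replicate a true) [some true]
    (y.map some ++ none :: List.replicate b (some true))
  simp only [List.map_replicate, List.reverse_replicate, ← List.replicate_succ'] at h'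
  exact h'

/-- Decrement the left counter; the exit tells whether it was positive. -/
def decA : Frag Bool :=
  ((go .L).bind fun _ => scan .L).bind fun _ => (go .R).bind fun _ =>
    (act fun a => match a with
      | none => (false, none, HeadMove.N)
      | some _ => (true, none, HeadMove.R)).bind fun t => (scan .R).map fun _ => t

theorem decA_zero (y : List Bool) (b : ℕ) :
    decA.Evals (counterTape y 0 b) false (counterTape y 0 b) := by
  have h := go_scan_left_end [] (y.map some ++ none :: List.replicate b (some true)) none
  simp only [List.map_nil, List.reverse_nil, List.nil_append] at h
  refine bind_evals h (bind_evals (act_mk₂ rfl (move_right_mk₂_cons _ _ _)) ?_)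
  rw [← mk₂_nil_left]
  refine bind_evals (act_mk₂ (e := false) (b := none) (d := .N) rfl rfl) ?_
  exact map_evals (f := fun _ => false) (scan_right [] [] _)

theorem decA_succ (y : List Bool) (a b : ℕ) :
    decA.Evals (counterTape y (a + 1) b) true (counterTape y a b) := by
  have h := go_scan_left_end (List.replicate (a + 1) true)
    (y.map some ++ none :: List.replicate b (some true)) none
  simp only [List.map_replicate, List.reverse_replicate] at h
  refine bind_evals h (bind_evals (act_mk₂ rfl (move_right_mk₂_cons _ _ _)) ?_)
  refine bind_evals (act_mk₂ (e := true) (b := none) (d := .R) rfl (move_right_mk₂_cons _ _ _)) ?_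
  have h' := scan_right (List.replicate a true) [none, none]
    (y.map some ++ none :: List.replicate b (some true))
  simp only [List.map_replicate, List.reverse_replicate] at h'
  have e : ∀ r, Tape.mk₂ (List.replicate a (some true) ++ [none, none]) r =
      Tape.mk₂ (List.replicate a (some true)) r := by
    intro r
    have : (ListBlank.mk (List.replicate a (some true) ++ [none, none])) =
      ListBlank.mk (List.replicate a (some true)) := Quotient.sound (Or.inr ⟨2, rfl⟩)
    simp only [Tape.mk₂, this]
  rw [e] at h'
  exact map_evals (f := fun _ => true) h'

/-- Increment the right counter. The word `y` lies between the head and the counter, so every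
operation on the right counter crosses it twice. -/
def incB : Frag Unit :=
  ((go .R).bind fun _ => scan .R).bind fun _ => ((go .R).bind fun _ => scan .R).bind fun _ =>
    (put (some true) .N).bind fun _ =>
      ((go .L).bind fun _ => scan .L).bind fun _ => (go .L).bind fun _ => scan .L

/-- The way back from the end of the right counter to the first separating blank. -/
theorem return_evals (y : List Bool) (l r : List (Option Bool)) (b : ℕ) (c : Option Bool) :
    (((go .L).bind fun _ => scan .L).bind fun _ => (go .L).bind fun _ => scan .L).Evals
      (Tape.mk₂ (List.replicate b (some true) ++ none :: ((y.map some).reverse ++ none :: l))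
        (c :: r)) ()
      (Tape.mk₂ l (none :: (y.map some ++ none :: (List.replicate b (some true) ++ c :: r)))) := by
  have h := go_scan_left (List.replicate b true) ((y.map some).reverse ++ none :: l) r c
  simp only [List.map_replicate, List.reverse_replicate] at h
  refine bind_evals h ?_
  have h' := go_scan_left y.reverse l (List.replicate b (some true) ++ c :: r) none
  simp only [List.map_reverse, List.reverse_reverse] at h'
  exact h'

theorem incB_evals (y : List Bool) (a b : ℕ) :
    incB.Evals (counterTape y a b) () (counterTape y a (b + 1)) := by
  refine bind_evals (go_scan_right y _ _ _) ?_
  have h := go_scan_right_end (List.replicate b true)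
    ((y.map some).reverse ++ none :: List.replicate a (some true)) none
  simp only [List.map_replicate, List.reverse_replicate] at h
  refine bind_evals h (bind_evals (act_mk₂ (e := ()) (b := some true) (d := .N) rfl rfl) ?_)
  have h' := return_evals y (List.replicate a (some true)) [] b (some true)
  rw [← List.replicate_succ'] at h'
  exact h'

/-- Decrement the right counter; the exit tells whether it was positive. -/
def decB : Frag Bool :=
  ((go .R).bind fun _ => scan .R).bind fun _ => ((go .R).bind fun _ => scan .R).bind fun _ =>
    (go .L).bind fun _ => (act fun a => (a.isSome, none, HeadMove.N)).bind fun t =>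
      match t with
      | false => ((go .L).bind fun _ => scan .L).map fun _ => false
      | true => (((go .L).bind fun _ => scan .L).bind fun _ => (go .L).bind fun _ => scan .L).map
          fun _ => true

theorem decB_zero (y : List Bool) (a : ℕ) :
    decB.Evals (counterTape y a 0) false (counterTape y a 0) := by
  refine bind_evals (go_scan_right y _ _ _) ?_
  refine bind_evals (go_scan_right_end [] _ none) ?_
  refine bind_evals (act_mk₂ rfl (move_left_mk₂_cons _ _ _)) ?_
  refine bind_evals (act_mk₂ (e := false) (b := none) (d := .N) rfl rfl) ?_
  have h := go_scan_left y.reverse (List.replicate a (some true)) [none] none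
  simp only [List.map_reverse, List.reverse_reverse] at h
  rw [show (none :: (y.map some ++ [none, none])) = (none :: (y.map some ++ [none])) ++ [none] by
    simp, mk₂_append_none] at h
  exact map_evals (f := fun _ => false) h

theorem decB_succ (y : List Bool) (a b : ℕ) :
    decB.Evals (counterTape y a (b + 1)) true (counterTape y a b) := by
  refine bind_evals (go_scan_right y _ _ _) ?_
  have h := go_scan_right_end (List.replicate (b + 1) true)
    ((y.map some).reverse ++ none :: List.replicate a (some true)) none
  simp only [List.map_replicate, List.reverse_replicate] at h
  refine bind_evals h ?_
  refine bind_evals (act_mk₂ rfl (move_left_mk₂_cons _ _ _)) ?_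
  refine bind_evals (act_mk₂ (e := true) (b := none) (d := .N) rfl rfl) ?_
  have h' := return_evals y (List.replicate a (some true)) [none] b none
  have e : (none :: (y.map some ++ none :: (List.replicate b (some true) ++ [none, none]))) =
      (none :: (y.map some ++ none :: List.replicate b (some true))) ++ [none] ++ [none] := by simp
  rw [e, mk₂_append_none, mk₂_append_none] at h'
  exact map_evals (f := fun _ => true) h'

end Frag

namespace Frag

variable {E : Type}

/-! ### Arithmetic on the left counter -/

/-- Run a fragment `n` times. -/
def repeatN (F : Frag Unit) : ℕ → Frag Unit
  | 0 => pure ()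
  | n + 1 => F.bind fun _ => repeatN F n

theorem repeatN_incA (y : List Bool) (n a b : ℕ) :
    (repeatN incA n).Evals (counterTape y a b) () (counterTape y (a + n) b) := by
  induction n generalizing a with
  | zero => exact pure_evals _ _
  | succ n ih =>
    refine bind_evals (incA_evals y a b) ?_
    rw [show a + (n + 1) = a + 1 + n by omega]
    exact ih _

theorem repeatN_incB (y : List Bool) (n a b : ℕ) :
    (repeatN incB n).Evals (counterTape y a b) () (counterTape y a (b + n)) := by
  induction n generalizing b with
  | zero => exact pure_evals _ _
  | succ n ih =>
    refine bind_evals (incB_evals y a b) ?_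
    rw [show b + (n + 1) = b + 1 + n by omega]
    exact ih _

/-- Empty the left counter, adding `p` times its content to the right one. -/
def drainA (p : ℕ) : Frag Unit :=
  loop (decA.bind fun t => match t with
    | false => pure (some ())
    | true => (repeatN incB p).map fun _ => none)

theorem drainA_evals (y : List Bool) (p a b : ℕ) :
    (drainA p).Evals (counterTape y a b) () (counterTape y 0 (b + p * a)) := by
  induction a generalizing b with
  | zero => exact loop_exit (bind_evals (decA_zero y b) (pure_evals _ _))
  | succ a ih =>
    refine loop_continue (bind_evals (decA_succ y a b)
      (map_evals (f := fun _ => none) (repeatN_incB y p a b))) ?_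
    rw [show b + p * (a + 1) = b + p + p * a by ring]
    exact ih _

/-- Empty the right counter, adding `p` times its content to the left one. -/
def drainB (p : ℕ) : Frag Unit :=
  loop (decB.bind fun t => match t with
    | false => pure (some ())
    | true => (repeatN incA p).map fun _ => none)

theorem drainB_evals (y : List Bool) (p a b : ℕ) :
    (drainB p).Evals (counterTape y a b) () (counterTape y (a + p * b) 0) := by
  induction b generalizing a with
  | zero => exact loop_exit (bind_evals (decB_zero y a) (pure_evals _ _))
  | succ b ih =>
    refine loop_continue (bind_evals (decB_succ y a b)
      (map_evals (f := fun _ => none) (repeatN_incA y p a b))) ?_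
    rw [show a + p * (b + 1) = a + p + p * b by ring]
    exact ih _

/-- Multiply the left counter by `p`. -/
def mulA (p : ℕ) : Frag Unit := (drainA p).bind fun _ => drainB 1

theorem mulA_evals (y : List Bool) (p a : ℕ) :
    (mulA p).Evals (counterTape y a 0) () (counterTape y (a * p) 0) := by
  refine bind_evals (drainA_evals y p a 0) ?_
  rw [show a * p = 0 + 1 * (0 + p * a) by ring]
  exact drainB_evals y 1 0 _

/-- Decrement the left counter up to `p` times; the exit is the number of successes. -/
def decUpTo : (p : ℕ) → Frag (Fin (p + 1))
  | 0 => pure 0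
  | p + 1 => decA.bind fun t => match t with
    | false => pure 0
    | true => (decUpTo p).map Fin.succ

theorem decUpTo_full (y : List Bool) (p a b : ℕ) :
    (decUpTo p).Evals (counterTape y (p + a) b) (Fin.last p) (counterTape y a b) := by
  induction p with
  | zero => simp only [Nat.zero_add]; exact pure_evals _ _
  | succ p ih =>
    rw [show p + 1 + a = p + a + 1 by omega]
    exact bind_evals (decA_succ y _ b) (map_evals (f := Fin.succ) ih)

theorem decUpTo_part (y : List Bool) (p b : ℕ) (j : Fin (p + 1)) :
    (decUpTo p).Evals (counterTape y j b) j (counterTape y 0 b) := by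
  induction p with
  | zero =>
    obtain rfl : j = 0 := Fin.ext (by omega)
    exact pure_evals _ _
  | succ p ih =>
    refine Fin.cases ?_ (fun j => ?_) j
    · exact bind_evals (decA_zero y b) (pure_evals _ _)
    · exact bind_evals (decA_succ y j b) (map_evals (f := Fin.succ) (ih j))

/-- The division loop: subtract `p` from the left counter as long as possible, counting on the
right one; the exit is the remainder. -/
def divLoop (p : ℕ) : Frag (Fin (p + 1)) :=
  loop ((decUpTo p).bind fun j =>
    if j = Fin.last p then incB.map fun _ => none else pure (some j))

theorem divLoop_evals (y : List Bool) (p q b : ℕ) (j : Fin (p + 1)) (hj : j ≠ Fin.last p) :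
    (divLoop p).Evals (counterTape y (p * q + j) b) j (counterTape y 0 (b + q)) := by
  induction q generalizing b with
  | zero =>
    rw [Nat.mul_zero, Nat.zero_add]
    refine loop_exit (bind_evals (decUpTo_part y p b j) ?_)
    rw [if_neg hj]
    exact pure_evals _ _
  | succ q ih =>
    rw [show p * (q + 1) + j = p + (p * q + j) by ring, show b + (q + 1) = b + 1 + q by omega]
    refine loop_continue (bind_evals (decUpTo_full y p _ b) ?_) (ih _)
    rw [if_pos rfl]
    exact map_evals (f := fun _ => none) (incB_evals y _ b)

/-- Divide the left counter by `p` if it is divisible by `p`, as told by the exit. Otherwise the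
counter is rebuilt from quotient and remainder and so keeps its value. -/
def divA (p : ℕ) : Frag Bool :=
  (divLoop p).bind fun j =>
    if j = 0 then (drainB 1).map fun _ => true
    else ((drainB p).bind fun _ => repeatN incA j).map fun _ => false

theorem divA_of_dvd (y : List Bool) {p : ℕ} (hp : 0 < p) (a : ℕ) :
    (divA p).Evals (counterTape y (a * p) 0) true (counterTape y a 0) := by
  have h := divLoop_evals y p a 0 0 (by
    intro h; have := congrArg Fin.val h; simp at this; omega)
  simp only [Fin.val_zero, Nat.add_zero, Nat.mul_comm p a] at h
  refine bind_evals h ?_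
  rw [if_pos rfl]
  have h' := drainB_evals y 1 0 (0 + a)
  rw [show 0 + 1 * (0 + a) = a by ring] at h'
  exact map_evals (f := fun _ => true) h'

theorem divA_of_not_dvd (y : List Bool) {p : ℕ} (hp : 0 < p) {a : ℕ} (ha : ¬ p ∣ a) :
    (divA p).Evals (counterTape y a 0) false (counterTape y a 0) := by
  have hlt := Nat.mod_lt a hp
  have h := divLoop_evals y p (a / p) 0 ⟨a % p, by omega⟩ (by
    intro h; have := congrArg Fin.val h; simp at this; omega)
  have e : p * (a / p) + a % p = a := Nat.div_add_mod a p
  simp only [e] at h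
  refine bind_evals h ?_
  rw [if_neg (by
    intro h; exact ha (Nat.dvd_of_mod_eq_zero (by simpa using congrArg Fin.val h)))]
  refine map_evals (f := fun _ => false) (e := ())
    (bind_evals (e' := ()) (drainB_evals y p 0 _) ?_)
  have h' := repeatN_incA y (a % p) (0 + p * (0 + a / p)) 0
  rw [show 0 + p * (0 + a / p) + a % p = a by rw [Nat.zero_add, Nat.zero_add, e]] at h'
  exact h'

/-! ### Register machines -/

/-- The registers `v i` stored in one number, as exponents of primes: incrementing a register is a
multiplication by a fixed prime, and decrementing it is a division. -/
noncomputable def regCode (v : ℕ →₀ ℕ) : ℕ := v.prod fun i e => Nat.nth Nat.Prime i ^ e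

theorem regCode_add_single (v : ℕ →₀ ℕ) (i n : ℕ) :
    regCode (v + Finsupp.single i n) = regCode v * Nat.nth Nat.Prime i ^ n := by
  rw [regCode, Finsupp.prod_add_index' (by simp) (by simp [pow_add])]
  simp [regCode]

theorem not_dvd_regCode {v : ℕ →₀ ℕ} {i : ℕ} (h : v i = 0) :
    ¬ Nat.nth Nat.Prime i ∣ regCode v := by
  intro hd
  have hp : ∀ i, (Nat.nth Nat.Prime i).Prime := Nat.prime_nth_prime
  rw [regCode, Finsupp.prod, (hp i).prime.dvd_finsetProd_iff] at hd
  obtain ⟨j, hj, hd⟩ := hd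
  have e := (Nat.prime_dvd_prime_iff_eq (hp i) (hp j)).1 ((hp i).dvd_of_dvd_pow hd)
  have := Nat.nth_injective Nat.infinite_setOfPred_prime e
  subst this
  simp [h] at hj

/-- Evaluation of a fragment that acts on registers. They are kept in the left counter, and the
right counter is scratch space of the arithmetic operations, empty between them. -/
def REvals (F : Frag E) (y : List Bool) (v : ℕ →₀ ℕ) (e : E) (v' : ℕ →₀ ℕ) : Prop :=
  F.Evals (counterTape y (regCode v) 0) e (counterTape y (regCode v') 0)

/-- Increment register `i`. -/
noncomputable def inc (i : ℕ) : Frag Unit := mulA (Nat.nth Nat.Prime i)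

theorem inc_evals (y : List Bool) (i : ℕ) (v : ℕ →₀ ℕ) :
    (inc i).REvals y v () (v + Finsupp.single i 1) := by
  rw [REvals, regCode_add_single, pow_one]
  exact mulA_evals y _ _

/-- Decrement register `i`; the exit tells whether it was positive. -/
noncomputable def dec (i : ℕ) : Frag Bool := divA (Nat.nth Nat.Prime i)

theorem dec_pos (y : List Bool) (i : ℕ) (v : ℕ →₀ ℕ) :
    (dec i).REvals y (v + Finsupp.single i 1) true v := by
  rw [REvals, regCode_add_single, pow_one]
  exact divA_of_dvd y (Nat.prime_nth_prime i).pos _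

theorem dec_zero (y : List Bool) {i : ℕ} {v : ℕ →₀ ℕ} (h : v i = 0) :
    (dec i).REvals y v false v :=
  divA_of_not_dvd y (Nat.prime_nth_prime i).pos (not_dvd_regCode h)

theorem bind_revals {E' : Type} [Fintype E] {F : Frag E} {G : E → Frag E'} {y : List Bool}
    {v v' v'' : ℕ →₀ ℕ} {e : E} {e' : E'}
    (h : F.REvals y v e v') (h' : (G e).REvals y v' e' v'') : (F.bind G).REvals y v e' v'' :=
  bind_evals h h'

/-- Repeat `body` while register `i` can be decremented. -/
noncomputable def whileDec (i : ℕ) (body : Frag Unit) : Frag Unit :=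
  loop ((dec i).bind fun t => match t with
    | false => pure (some ())
    | true => body.map fun _ => none)

theorem whileDec_zero (y : List Bool) {i : ℕ} {body : Frag Unit} {v : ℕ →₀ ℕ} (h : v i = 0) :
    (whileDec i body).REvals y v () v :=
  loop_exit (bind_evals (dec_zero y h) (pure_evals _ _))

theorem whileDec_succ {y : List Bool} {i : ℕ} {body : Frag Unit} {v v' v'' : ℕ →₀ ℕ}
    (h : body.REvals y v () v') (h' : (whileDec i body).REvals y v' () v'') :
    (whileDec i body).REvals y (v + Finsupp.single i 1) () v'' :=
  loop_continue (bind_evals (dec_pos y i v) (map_evals (f := fun _ => none) h)) h'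

/-- The registers after taking one from a positive register. -/
theorem exists_add_single {v : ℕ →₀ ℕ} {i n : ℕ} (h : v i = n + 1) :
    ∃ w : ℕ →₀ ℕ, v = w + Finsupp.single i 1 ∧ w i = n ∧ ∀ j, j ≠ i → w j = v j := by
  refine ⟨v.update i n, ?_, by simp, fun j hj => by simp [hj]⟩
  ext j
  by_cases hj : j = i
  · subst hj; simp [h]
  · simp [hj]

/-- Run a list of fragments one after the other. -/
def seqList : List (Frag Unit) → Frag Unit
  | [] => pure ()
  | F :: l => F.bind fun _ => seqList l

theorem seqList_inc (y : List Bool) (ts : List ℕ) (v v' : ℕ →₀ ℕ)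
    (h : ∀ j, v' j = v j + ts.count j) : (seqList (ts.map inc)).REvals y v () v' := by
  induction ts generalizing v with
  | nil =>
    have : v' = v := by ext j; simp [h]
    subst this
    exact pure_evals _ _
  | cons t ts ih =>
    refine bind_revals (inc_evals y t v) (ih _ fun j => ?_)
    rw [h, List.count_cons, Finsupp.add_apply, Finsupp.single_apply]
    simp only [beq_iff_eq]
    ring

/-- Empty register `a`, adding its content to each of the registers in `ts`. -/
noncomputable def drain (a : ℕ) (ts : List ℕ) : Frag Unit :=
  whileDec a (seqList (ts.map inc))

theorem drain_evals (y : List Bool) (a : ℕ) (ts : List ℕ) (ha : a ∉ ts) (v v' : ℕ →₀ ℕ)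
    (h0 : v' a = 0) (h : ∀ j, j ≠ a → v' j = v j + v a * ts.count j) :
    (drain a ts).REvals y v () v' := by
  obtain ⟨n, hn⟩ : ∃ n, v a = n := ⟨_, rfl⟩
  induction n generalizing v with
  | zero =>
    have : v' = v := by
      ext j
      by_cases hj : j = a
      · rw [hj, h0, hn]
      · simp [h j hj, hn]
    subst this
    exact whileDec_zero y hn
  | succ n ih =>
    obtain ⟨w, rfl, hw, hw'⟩ := exists_add_single hn
    have hc : ts.count a = 0 := List.count_eq_zero.2 ha
    let w' : ℕ →₀ ℕ := w + (ts.map fun t => Finsupp.single t 1).sum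
    have e : ∀ j, w' j = w j + ts.count j := by
      intro j
      simp only [w', Finsupp.add_apply]
      congr 1
      clear_value w'
      clear ha hc h ih
      induction ts with
      | nil => simp
      | cons t ts ih' =>
        simp only [List.map_cons, List.sum_cons, Finsupp.add_apply, ih', List.count_cons,
          Finsupp.single_apply, beq_iff_eq]
        ring
    refine whileDec_succ (seqList_inc y ts w w' e) (ih w' ?_ ?_)
    · intro j hj
      rw [h j hj, e, e, hn, hw, hc, hw' j hj]
      ring
    · rw [e, hw, hc]; rfl

/-- Empty a register. -/
noncomputable def clear (a : ℕ) : Frag Unit := drain a []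

theorem clear_evals (y : List Bool) (a : ℕ) (v : ℕ →₀ ℕ) :
    (clear a).REvals y v () (v.update a 0) :=
  drain_evals y a [] (by simp) v _ (by simp) fun j hj => by simp [hj]

/-- Copy register `a` to `out`, with scratch register `s`. -/
noncomputable def copy (a out s : ℕ) : Frag Unit :=
  (clear out).bind fun _ => (drain a [s]).bind fun _ => drain s [a, out]

theorem copy_evals (y : List Bool) {a out s : ℕ} (h1 : a ≠ out) (h2 : a ≠ s) (h3 : out ≠ s)
    (v : ℕ →₀ ℕ) (hs : v s = 0) : (copy a out s).REvals y v () (v.update out (v a)) := by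
  refine bind_revals (clear_evals y out v) (bind_revals
    (drain_evals y a [s] (by simpa using h2) _ (((v.update out 0).update a 0).update s (v a)) ?_ ?_)
    (drain_evals y s [a, out] (by simp [h2.symm, h3.symm]) _ _ ?_ ?_))
  · simp [h2]
  · intro j hj
    by_cases h : j = s
    · subst h; simp [h1, h3.symm, hs]
    · simp [h, hj, Ne.symm h]
  · simp [h3.symm, hs]
  · intro j hj
    by_cases h : j = a
    · subst h; simp [h1, h2]
    · by_cases h' : j = out
      · subst h'; simp [h1, h3, h]
      · simp [h, h', hj, Ne.symm h, Ne.symm h']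

theorem seqList_clear (y : List Bool) (ts : List ℕ) (v v' : ℕ →₀ ℕ)
    (h : ∀ j, v' j = if j ∈ ts then 0 else v j) : (seqList (ts.map clear)).REvals y v () v' := by
  induction ts generalizing v with
  | nil =>
    have : v' = v := by ext j; simp [h]
    subst this
    exact pure_evals _ _
  | cons t ts ih =>
    refine bind_revals (clear_evals y t v) (ih _ fun j => ?_)
    rw [h]
    by_cases hj : j = t
    · simp [hj]
    · simp [hj]

/-- The fragment `F` computes `f` from the registers `inp` to the register `out`, provided that all
registers from `N` on are empty, and changes no other register. -/
def Computes {n : ℕ} (F : Frag Unit) (f : List.Vector ℕ n → ℕ) (inp : Fin n → ℕ) (out N : ℕ) :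
    Prop :=
  ∀ y v, (∀ j, N ≤ j → v j = 0) →
    F.REvals y v () (v.update out (f (List.Vector.ofFn fun i => v (inp i))))

/-- Tuples of functions are computed one component after the other, into the registers from `N` on;
register `N + i` holds the result for every `i` in the list of components already treated. -/
theorem exists_computes_seq {n m : ℕ} {g : Fin m → List.Vector ℕ n → ℕ} {inp : Fin n → ℕ} {N : ℕ}
    (hinp : ∀ i, inp i < N) {F : Fin m → Frag Unit}
    (hF : ∀ i, (F i).Computes (g i) inp (N + i) (N + m)) (y : List Bool) (l : List (Fin m))
    (v : ℕ →₀ ℕ) (hv : ∀ j, N + m ≤ j → v j = 0) :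
    ∃ v', (seqList (l.map F)).REvals y v () v' ∧
      (∀ i ∈ l, v' (N + i) = g i (List.Vector.ofFn fun i => v (inp i))) ∧
      ∀ j, (∀ i ∈ l, j ≠ N + i) → v' j = v j := by
  induction l generalizing v with
  | nil => exact ⟨v, pure_evals _ _, by simp, by simp⟩
  | cons i l ih =>
    obtain ⟨v', h1, h2, h3⟩ := ih (v.update (N + i)
      (g i (List.Vector.ofFn fun i => v (inp i)))) fun j hj => by
        have := i.2
        rw [Finsupp.update_apply, if_neg (by omega), hv j hj]
    have e : ∀ k, (v.update (N + i) (g i (List.Vector.ofFn fun i => v (inp i)))) (inp k) =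
        v (inp k) := fun k => by
      have := hinp k
      rw [Finsupp.update_apply, if_neg (by omega)]
    simp only [e] at h2
    refine ⟨v', bind_revals (hF i y v hv) h1, ?_, ?_⟩
    · intro k hk
      by_cases hkl : k ∈ l
      · exact h2 k hkl
      · have : k = i := by simpa [hkl] using hk
        subst this
        rw [h3 _ fun j hj h => hkl ?_]
        · simp
        · have : k = j := Fin.ext (by omega)
          rwa [this]
    · intro j hj
      rw [h3 j fun k hk => hj k (List.mem_cons_of_mem _ hk), Finsupp.update_apply,
        if_neg (hj i List.mem_cons_self)]

/-- The loop for primitive recursion: register `N` counts up, register `N + 1` counts down, and the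
intermediate result in `out` is replaced through register `N + 2`. -/
noncomputable def precLoop (G : Frag Unit) (out N : ℕ) : Frag Unit :=
  whileDec (N + 1) (G.bind fun _ => (copy (N + 2) out (N + 3)).bind fun _ => inc N)

theorem precLoop_evals {n : ℕ} {g : List.Vector ℕ (n + 2) → ℕ} {f : ℕ} {inp : Fin n → ℕ} {out N : ℕ}
    (hinp : ∀ i, inp i < N) (hout : out < N) (hne : ∀ i, inp i ≠ out) {G : Frag Unit}
    (hG : G.Computes g (Fin.cons N (Fin.cons out inp)) (N + 2) (N + 3))
    (y : List Bool) (u : List.Vector ℕ n) (k : ℕ) (v : ℕ →₀ ℕ) (hk : v (N + 1) = k)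
    (hu : List.Vector.ofFn (fun i => v (inp i)) = u) (hv : ∀ j, N + 3 ≤ j → v j = 0)
    (ho : v out = Nat.rec f (fun y IH => g (y ::ᵥ IH ::ᵥ u)) (v N)) :
    ∃ v', (precLoop G out N).REvals y v () v' ∧
      v' out = Nat.rec f (fun y IH => g (y ::ᵥ IH ::ᵥ u)) (v N + k) ∧
      ∀ j, j ≠ out → j ≠ N → j ≠ N + 1 → j ≠ N + 2 → v' j = v j := by
  induction k generalizing v with
  | zero => exact ⟨v, whileDec_zero y hk, ho, fun _ _ _ _ _ => rfl⟩
  | succ k ih =>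
    obtain ⟨w, rfl, hw, hw'⟩ := exists_add_single hk
    set v := w + Finsupp.single (N + 1) 1
    have hwv : ∀ j, N + 3 ≤ j → w j = 0 := fun j hj => by rw [hw' j (by omega), hv j hj]
    have hwu : (List.Vector.ofFn fun i => w ((Fin.cons N (Fin.cons out inp) : Fin (n + 2) → ℕ) i)) =
        w N ::ᵥ w out ::ᵥ u := by
      have : (List.Vector.ofFn fun i => w (inp i)) = u := by
        rw [← hu]
        congr 1
        funext i
        exact hw' _ (by have := hinp i; omega)
      rw [← this]
      rfl
    have h1 := hG y w hwv
    rw [hwu] at h1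
    set w1 := w.update (N + 2) (g (w N ::ᵥ w out ::ᵥ u)) with hw1
    have h2 := copy_evals y (a := N + 2) (out := out) (s := N + 3) (by omega) (by omega) (by omega)
      w1 (by rw [hw1, Finsupp.update_apply, if_neg (by omega), hwv _ le_rfl])
    set w2 := w1.update out (w1 (N + 2)) with hw2
    have h3 := inc_evals y N w2
    set w3 := w2 + Finsupp.single N 1 with hw3
    have e : ∀ j, j ≠ out → j ≠ N → j ≠ N + 1 → j ≠ N + 2 → w3 j = v j := by
      intro j j1 j2 j3 j4
      simp [hw3, hw2, hw1, j1, j4, Ne.symm j2, hw' j j3]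
    have eN : w3 N = v N + 1 := by
      simp [hw3, hw2, hw1, hout.ne', hw' N (by omega)]
    have eo : w3 out = g (v N ::ᵥ v out ::ᵥ u) := by
      simp [hw3, hw2, hw1, hout.ne, hw' N (by omega), hw' out (by omega)]
    obtain ⟨v', i1, i2, i3⟩ := ih w3
      (by simp [hw3, hw2, hw1, show N + 1 ≠ out by omega, hw])
      (by
        rw [← hu]
        congr 1
        funext i
        have := hinp i
        exact e _ (hne i) (by omega) (by omega) (by omega))
      (fun j hj => by rw [e j (by omega) (by omega) (by omega) (by omega), hv j hj])
      (by rw [eo, eN, ho])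
    refine ⟨v', whileDec_succ (bind_revals h1 (bind_revals h2 h3)) i1, ?_, ?_⟩
    · rw [i2, eN, show v N + 1 + k = v N + (k + 1) by omega]
    · intro j j1 j2 j3 j4
      rw [i3 j j1 j2 j3 j4, e j j1 j2 j3 j4]

/-- Primitive recursive functions are computed by fragments acting on registers. Intermediate
results are kept in registers from `N` on and are cleared at the end, so the bound `N` can be raised
in the recursive calls. -/
theorem exists_computes {n : ℕ} {f : List.Vector ℕ n → ℕ} (hf : Nat.Primrec' f) :
    ∀ (inp : Fin n → ℕ) (out N : ℕ), (∀ i, inp i < N) → out < N → (∀ i, inp i ≠ out) →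
      ∃ F : Frag Unit, F.Computes f inp out N := by
  induction hf with
  | zero => exact fun inp out N _ _ _ => ⟨clear out, fun y v _ => clear_evals y out v⟩
  | succ =>
    intro inp out N hinp hout hne
    refine ⟨(copy (inp 0) out N).bind fun _ => inc out, fun y v hv => ?_⟩
    have h := bind_revals (G := fun _ => inc out)
      (copy_evals y (hne 0) (hinp 0).ne hout.ne v (hv N le_rfl)) (inc_evals y out _)
    convert h using 1
    ext j
    by_cases hj : j = out
    · subst hj; simp [List.Vector.ofFn]
    · simp [hj]
  | get i =>
    intro inp out N hinp hout hne
    refine ⟨copy (inp i) out N, fun y v hv => ?_⟩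
    simp only [List.Vector.get_ofFn]
    exact copy_evals y (hne i) (hinp i).ne hout.ne v (hv N le_rfl)
  | @comp n m f g _ _ ihf ihg =>
    intro inp out N hinp hout hne
    choose F hF using fun i => ihg i inp (N + i) (N + m)
      (fun k => by have := hinp k; omega) (by omega) (fun k => by have := hinp k; omega)
    obtain ⟨F', hF'⟩ := ihf (fun i => N + i) out (N + m) (fun k => by omega) (by omega)
      (fun k => by omega)
    refine ⟨(seqList ((List.finRange m).map F)).bind fun _ => F'.bind fun _ =>
      seqList (((List.finRange m).map fun i => N + i.1).map clear), fun y v hv => ?_⟩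
    obtain ⟨v', h1, h2, h3⟩ := exists_computes_seq hinp hF y (List.finRange m) v
      fun j hj => hv j (by omega)
    refine bind_revals h1 (bind_revals (hF' y v' fun j hj => ?_) (seqList_clear y _ _ _ fun j => ?_))
    · rw [h3 j fun i _ => by omega, hv j (by omega)]
    · simp only [h2 _ (List.mem_finRange _)]
      by_cases hj : j ∈ (List.finRange m).map fun i => N + i.1
      · rw [if_pos hj]
        obtain ⟨i, -, rfl⟩ := List.mem_map.1 hj
        rw [Finsupp.update_apply, if_neg (by omega), hv _ (by omega)]
      · rw [if_neg hj, Finsupp.update_apply, Finsupp.update_apply]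
        split_ifs
        · rfl
        · refine (h3 j fun i hi h => hj ?_).symm
          exact List.mem_map.2 ⟨i, hi, h.symm⟩
  | @prec n f g _ _ ihf ihg =>
    intro inp out N hinp hout hne
    obtain ⟨F, hF⟩ := ihf (fun i => inp i.succ) out N (fun i => hinp _) hout (fun i => hne _)
    obtain ⟨G, hG⟩ := ihg (Fin.cons N (Fin.cons out fun i => inp i.succ)) (N + 2) (N + 3)
      (Fin.cases (by simp) (Fin.cases (by simp; omega) fun i => by
        have := hinp i.succ; simp; omega)) (by omega)
      (Fin.cases (by simp) (Fin.cases (by simp; omega) fun i => by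
        have := hinp i.succ; simp; omega))
    refine ⟨F.bind fun _ => (copy (inp 0) (N + 1) N).bind fun _ => (precLoop G out N).bind fun _ =>
      seqList ([N, N + 1, N + 2].map clear), fun y v hv => ?_⟩
    have h1 := hF y v hv
    set u := List.Vector.ofFn fun i : Fin n => v (inp i.succ) with hu
    set w1 := v.update out (f u) with hw1
    have e1 : ∀ i, w1 (inp i) = v (inp i) := fun i => by simp [hw1, hne i]
    have h2 := copy_evals y (a := inp 0) (out := N + 1) (s := N) (by have := hinp 0; omega)
      (hinp 0).ne (by omega) w1 (by simp [hw1, hout.ne', hv])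
    set w2 := w1.update (N + 1) (w1 (inp 0)) with hw2
    obtain ⟨v', h3, h4, h5⟩ := precLoop_evals (f := f u) (fun i : Fin n => hinp i.succ) hout
      (fun i => hne _) hG y u (v (inp 0)) w2 (by simp [hw2, e1])
      (by
        rw [hu]
        congr 1
        funext i
        have := hinp i.succ
        rw [hw2, Finsupp.update_apply, if_neg (by omega), e1])
      (fun j hj => by
        rw [hw2, Finsupp.update_apply, if_neg (by omega), hw1, Finsupp.update_apply,
          if_neg (by omega), hv j (by omega)])
      (by
        have : w2 N = 0 := by simp [hw2, hw1, hout.ne', hv]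
        rw [this]
        simp [hw2, hw1, show out ≠ N + 1 by omega])
    refine bind_revals h1 (bind_revals h2 (bind_revals h3 (seqList_clear y _ _ _ fun j => ?_)))
    have hN : w2 N = 0 := by simp [hw2, hw1, hout.ne', hv]
    rw [hN, Nat.zero_add] at h4
    by_cases hj : j = out
    · subst hj
      rw [if_neg (by simp; omega), h4]
      simp [List.Vector.ofFn, hu]
    · by_cases hj' : j ∈ [N, N + 1, N + 2]
      · rw [if_pos hj', Finsupp.update_apply, if_neg hj, hv j]
        simp at hj'; omega
      · rw [if_neg hj', Finsupp.update_apply, if_neg hj]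
        simp only [List.mem_cons, List.not_mem_nil, or_false, not_or] at hj'
        rw [h5 j hj hj'.1 hj'.2.1 hj'.2.2]
        simp [hw2, hw1, hj, hj'.2.1]

end Frag

/-! ### Input, output, and machines for primitive recursive functions -/

/-- The value of a binary word, most significant bit first. -/
def binValue (y : List Bool) : ℕ := y.foldl (fun n b => 2 * n + b.toNat) 0

/-- The number of a binary string: the value of the string with a leading `1`. -/
def wordNum (x : List Bool) : ℕ := binValue (true :: x)

theorem binValue_append_singleton (y : List Bool) (b : Bool) :
    binValue (y ++ [b]) = 2 * binValue y + b.toNat := by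
  simp [binValue]

theorem binValue_append_false (y : List Bool) (k : ℕ) :
    binValue (y ++ List.replicate k false) = binValue y * 2 ^ k := by
  induction k with
  | zero => simp
  | succ k ih =>
    rw [List.replicate_succ', ← List.append_assoc, binValue_append_singleton, ih, pow_succ]
    simp
    ring

theorem binValue_append_true (y : List Bool) (k : ℕ) :
    binValue (y ++ List.replicate k true) + 1 = (binValue y + 1) * 2 ^ k := by
  induction k with
  | zero => simp
  | succ k ih =>
    rw [List.replicate_succ', ← List.append_assoc, binValue_append_singleton, pow_succ,
      ← mul_assoc, ← ih]
    simp
    ring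

/-- A binary word ends in `1` and zeros, unless it consists of zeros. -/
theorem eq_replicate_or_exists (y : List Bool) :
    y = List.replicate y.length false ∨
      ∃ w k, y = w ++ true :: List.replicate k false := by
  induction y with
  | nil => exact Or.inl rfl
  | cons b y ih =>
    rcases ih with ih | ⟨w, k, ih⟩
    · cases b with
      | false => left; rw [List.length_cons, List.replicate_succ, ← ih]
      | true => exact Or.inr ⟨[], _, by rw [← ih]; rfl⟩
    · exact Or.inr ⟨b :: w, k, by rw [ih]; rfl⟩

namespace Frag

/-- Decrement the binary word left of the head; the exit tells whether it was positive. A word of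
zeros is overwritten by ones, since the borrow is not known to fail before the blank is reached. -/
def decBits : Frag Bool :=
  loop ((go .L).bind fun _ => act fun a => match a with
    | none => (some false, none, HeadMove.N)
    | some true => (some true, some false, HeadMove.N)
    | some false => (none, some true, HeadMove.N))

theorem decBits_pos (k : ℕ) (l r : List (Option Bool)) (a : Option Bool) :
    decBits.Evals (Tape.mk₂ (List.replicate k (some false) ++ some true :: l) (a :: r)) true
      (Tape.mk₂ l (some false :: (List.replicate k (some true) ++ a :: r))) := by
  induction k generalizing a r with
  | zero => exact loop_exit (bind_evals (act_mk₂ rfl (move_left_mk₂_cons _ _ _)) (act_mk₂ rfl rfl))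
  | succ k ih =>
    refine loop_continue (bind_evals (act_mk₂ rfl (move_left_mk₂_cons _ _ _)) (act_mk₂ rfl rfl)) ?_
    rw [List.replicate_succ', List.append_assoc]
    exact ih _ _

theorem decBits_zero (k : ℕ) (l r : List (Option Bool)) (a : Option Bool) :
    decBits.Evals (Tape.mk₂ (List.replicate k (some false) ++ none :: l) (a :: r)) false
      (Tape.mk₂ l (none :: (List.replicate k (some true) ++ a :: r))) := by
  induction k generalizing a r with
  | zero => exact loop_exit (bind_evals (act_mk₂ rfl (move_left_mk₂_cons _ _ _)) (act_mk₂ rfl rfl))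
  | succ k ih =>
    refine loop_continue (bind_evals (act_mk₂ rfl (move_left_mk₂_cons _ _ _)) (act_mk₂ rfl rfl)) ?_
    rw [List.replicate_succ', List.append_assoc]
    exact ih _ _

/-- Decrement the binary word of the tape; the exit tells whether it was positive. -/
def decWord : Frag Bool :=
  ((go .R).bind fun _ => scan .R).bind fun _ => decBits.bind fun t => match t with
    | false => pure false
    | true => ((go .L).bind fun _ => scan .L).map fun _ => true

theorem decWord_pos (w : List Bool) (k a b : ℕ) :
    decWord.Evals (counterTape (w ++ true :: List.replicate k false) a b) true
      (counterTape (w ++ false :: List.replicate k true) a b) := by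
  refine bind_evals (go_scan_right _ _ _ _) ?_
  have h := decBits_pos k ((w.map some).reverse ++ none :: List.replicate a (some true))
    (List.replicate b (some true)) none
  have h' := go_scan_left w.reverse (List.replicate a (some true))
    (List.replicate k (some true) ++ none :: List.replicate b (some true)) (some false)
  simp only [List.map_append, List.map_cons, List.map_replicate, List.reverse_append,
    List.reverse_cons, List.reverse_replicate, List.append_assoc,
    counterTape, List.map_reverse, List.reverse_reverse, List.cons_append] at h h' ⊢
  exact bind_evals h (map_evals (f := fun _ => true) h')

theorem decWord_zero (k a b : ℕ) :
    decWord.Evals (counterTape (List.replicate k false) a b) false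
      (counterTape (List.replicate k true) a b) := by
  refine bind_evals (go_scan_right _ _ _ _) ?_
  have h := decBits_zero k (List.replicate a (some true)) (List.replicate b (some true)) none
  simp only [List.map_replicate, List.reverse_replicate, counterTape] at h ⊢
  exact bind_evals h (pure_evals _ _)

/-- Add the value of the binary word of the tape to register `0`, decrementing the word to zero. -/
noncomputable def readWord : Frag Unit :=
  loop (decWord.bind fun t => match t with
    | false => pure (some ())
    | true => (inc 0).map fun _ => none)

theorem readWord_evals (y : List Bool) (v : ℕ →₀ ℕ) :
    ∃ y', readWord.Evals (counterTape y (regCode v) 0) ()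
      (counterTape y' (regCode (v + Finsupp.single 0 (binValue y))) 0) := by
  obtain ⟨n, hn⟩ : ∃ n, binValue y = n := ⟨_, rfl⟩
  induction n using Nat.strong_induction_on generalizing y v with
  | _ n ih =>
    rcases eq_replicate_or_exists y with h | ⟨w, k, rfl⟩
    · have h0 : binValue y = 0 := by
        have := binValue_append_false [] y.length
        rw [List.nil_append, ← h] at this
        simpa [binValue] using this
      refine ⟨List.replicate y.length true, ?_⟩
      rw [h0, Finsupp.single_zero, add_zero, h, List.length_replicate]
      exact loop_exit (bind_evals (decWord_zero _ _ _) (pure_evals _ _))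
    · have e : binValue (w ++ true :: List.replicate k false) =
          binValue (w ++ false :: List.replicate k true) + 1 := by
        have h1 := binValue_append_false (w ++ [true]) k
        have h2 := binValue_append_true (w ++ [false]) k
        simp only [List.append_assoc, List.singleton_append, binValue_append_singleton] at h1 h2
        simp only [Bool.toNat_true, Bool.toNat_false, add_zero] at h1 h2
        rw [h1, h2]
      obtain ⟨y', hy'⟩ := ih _ (by rw [← hn, e]; exact Nat.lt_succ_self _)
        (w ++ false :: List.replicate k true) (v + Finsupp.single 0 1) rfl
      refine ⟨y', loop_continue (bind_evals (decWord_pos w k _ _)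
        (map_evals (f := fun _ => none) (inc_evals _ 0 v))) ?_⟩
      rwa [e, add_comm (binValue _), Finsupp.single_add, ← add_assoc]

/-- Prepare the tape and read the input. The input is preceded by a `1`, so that leading zeros
matter, and the left counter is set to `1`, the code of empty registers. -/
noncomputable def input : Frag Unit :=
  (go .L).bind fun _ => (put (some true) .L).bind fun _ => incA.bind fun _ => readWord

theorem input_evals (x : List Bool) :
    ∃ y, input.Evals (Tape.mk₁ (x.map some)) ()
      (counterTape y (regCode (Finsupp.single 0 (wordNum x))) 0) := by
  obtain ⟨y, hy⟩ := readWord_evals (true :: x) 0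
  rw [zero_add] at hy
  refine ⟨y, ?_⟩
  have h1 : (go .L).Evals (Tape.mk₁ (x.map some)) () (Tape.mk₂ [] (none :: x.map some)) := by
    have := act_evals (fun a => ((), a, HeadMove.L)) (Tape.mk₁ (x.map some))
    simp only [Tape.write_self] at this
    rwa [Tape.mk₁, move_left_mk₂_nil] at this
  refine bind_evals h1 (bind_evals
    (act_mk₂ (e := ()) (b := some true) (d := .L) rfl (move_left_mk₂_nil _))
    (bind_evals (e := ()) ?_ hy))
  have h := incA_evals (true :: x) 0 0
  have e : counterTape (true :: x) 0 0 = Tape.mk₂ [] (none :: some true :: x.map some) :=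
    mk₂_append_none [] (none :: (true :: x).map some)
  rw [e] at h
  simpa [regCode] using h

/-- The output words: `0`, `1` and, for larger numbers, `10`. -/
def answerWord : ℕ → List Bool
  | 0 => [false]
  | 1 => [true]
  | _ => [true, false]

/-- Write an output word right of the two counters. -/
def output (n : ℕ) : Frag Unit :=
  ((go .R).bind fun _ => scan .R).bind fun _ => match n with
    | 0 => put (some false) .N
    | 1 => put (some true) .N
    | _ => (put (some true) .R).bind fun _ => put (some false) .L

theorem output_evals (y : List Bool) (a n : ℕ) :
    ∃ l, (output n).Evals (counterTape y a 0) () (Tape.mk₂ l ((answerWord n).map some)) := by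
  refine ⟨(y.map some).reverse ++ none :: List.replicate a (some true),
    bind_evals (go_scan_right y _ _ _) ?_⟩
  match n with
  | 0 => exact act_mk₂ (e := ()) rfl rfl
  | 1 => exact act_mk₂ (e := ()) rfl rfl
  | _ + 2 =>
    refine bind_evals (act_mk₂ (e := ()) (b := some true) (d := .R) rfl (move_right_mk₂_cons _ _ _)) ?_
    simp only [List.replicate_zero]
    rw [mk₂_nil_right]
    exact act_mk₂ (e := ()) rfl (move_left_mk₂_cons _ _ _)

end Frag

theorem tapeReads_mk₂ (l : List (Option Bool)) (w : List Bool) :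
    DTM.TapeReads (Tape.mk₂ l (w.map some)) w := by
  intro i hi
  rw [Tape.mk₂, Tape.mk'_nth_nat, ListBlank.nth_mk, List.getI_eq_getElem?_getD, List.getElem?_map]
  cases w[i]? <;> rfl

open Frag in
/-- For every primitive recursive function there is a Turing machine that outputs whether its value
is `0`, `1` or larger. -/
theorem exists_DTM_of_primrec {f : ℕ → ℕ} (hf : Primrec f) :
    ∃ M : DTM, ∀ x, M.Outputs x (answerWord (f (wordNum x))) := by
  obtain ⟨F, hF⟩ := exists_computes (Nat.Primrec'.prim_iff₁.2 hf) (fun _ => 0) 1 2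
    (by simp) (by simp) (by simp)
  refine ⟨(input.bind fun _ => F.bind fun _ => (dec 1).bind fun t => match t with
    | false => output 0
    | true => (dec 1).bind fun t => match t with
      | false => output 1
      | true => output 2).toDTM, fun x => ?_⟩
  obtain ⟨y, h1⟩ := input_evals x
  have h2 := hF y (Finsupp.single 0 (wordNum x)) fun j hj => by
    simp [show j ≠ 0 by omega]
  set v := (Finsupp.single 0 (wordNum x)).update 1 _ with hv
  have e : v 1 = f (wordNum x) := by
    rw [hv, Finsupp.update_apply, if_pos rfl]
    simp [List.Vector.ofFn]
  rw [← e]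
  rcases hn : v 1 with _ | n
  · obtain ⟨l, h3⟩ := output_evals y (regCode v) 0
    exact toDTM_outputs (bind_evals h1 (bind_evals h2 (bind_evals (dec_zero y hn) h3)))
      (tapeReads_mk₂ _ _)
  · obtain ⟨w, hw, hw1, -⟩ := exists_add_single hn
    have h3 := dec_pos y 1 w
    rw [← hw] at h3
    rcases n with _ | n
    · obtain ⟨l, h4⟩ := output_evals y (regCode w) 1
      exact toDTM_outputs (bind_evals h1 (bind_evals h2 (bind_evals h3
        (bind_evals (dec_zero y hw1) h4)))) (tapeReads_mk₂ _ _)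
    · obtain ⟨w', hw', -, -⟩ := exists_add_single hw1
      have h4 := dec_pos y 1 w'
      rw [← hw'] at h4
      obtain ⟨l, h5⟩ := output_evals y (regCode w') 2
      exact toDTM_outputs (bind_evals h1 (bind_evals h2 (bind_evals h3
        (bind_evals h4 h5)))) (tapeReads_mk₂ _ _)

/-! ### Polynomial-time machines compute primitive recursive functions -/

attribute [instance] DTM.finS

theorem primrec₂_pow : Primrec₂ ((· ^ ·) : ℕ → ℕ → ℕ) := Primrec₂.unpaired'.1 Nat.Primrec.pow

theorem primrec_polynomial_eval (p : Polynomial ℕ) : Primrec fun n : ℕ => p.eval n := by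
  induction p using Polynomial.induction_on' with
  | add p q hp hq => exact (Primrec.nat_add.comp hp hq).of_eq fun n => by simp
  | monomial k a =>
    exact (Primrec.nat_mul.comp (Primrec.const a)
      (primrec₂_pow.comp Primrec.id (Primrec.const k))).of_eq fun n => by simp

namespace DTM

/-- One step on configurations whose tape is given by two lists of cells, the left one in reverse.
In contrast to `Tape`, this representation is an encodable type. -/
def listStep (M : DTM) (c : M.S × List (Option Bool) × List (Option Bool)) :
    M.S × List (Option Bool) × List (Option Bool) :=
  if M.final c.1 then c else
    let q := M.δ c.1 c.2.2.headI
    match q.2.2 with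
    | HeadMove.L => (q.1, c.2.1.tail, c.2.1.headI :: q.2.1 :: c.2.2.tail)
    | HeadMove.R => (q.1, q.2.1 :: c.2.1, c.2.2.tail)
    | HeadMove.N => (q.1, c.2.1, q.2.1 :: c.2.2.tail)

/-- The configuration given by a state and two lists of cells. -/
def listCfg (M : DTM) (c : M.S × List (Option Bool) × List (Option Bool)) : M.Cfg :=
  ⟨c.1, Tape.mk₂ c.2.1 c.2.2⟩

theorem step_listCfg (M : DTM) (c : M.S × List (Option Bool) × List (Option Bool)) :
    M.step (M.listCfg c) = M.listCfg (M.listStep c) := by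
  obtain ⟨s, l, r⟩ := c
  cases hf : M.final s with
  | true => simp [step, listStep, listCfg, hf]
  | false =>
    simp only [step, listCfg, listStep, hf, Bool.false_eq_true, if_false]
    rw [show (Tape.mk₂ l r).head = r.headI from rfl,
      show (Tape.mk₂ l r).write (M.δ s r.headI).2.1 = Tape.mk₂ l ((M.δ s r.headI).2.1 :: r.tail)
      from rfl]
    cases (M.δ s r.headI).2.2 with
    | L =>
      simp only [moveHead, Tape.mk₂, Tape.move_left_mk', ListBlank.head_mk, ListBlank.tail_mk,
        ListBlank.cons_mk]
    | R => simp only [move_right_mk₂_cons]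
    | N => rfl

theorem run_eq_listCfg (M : DTM) (x : List Bool) (t : ℕ) :
    M.run x t = M.listCfg (M.listStep^[t] (M.init, [], x.map some)) := by
  induction t with
  | zero => rfl
  | succ t ih =>
    rw [run, Function.iterate_succ_apply', ← run, ih, step_listCfg, Function.iterate_succ_apply']

theorem run_add_of_haltsWithin {M : DTM} {x : List Bool} {t : ℕ} (h : M.HaltsWithin x t) (k : ℕ) :
    M.run x (t + k) = M.run x t := by
  induction k with
  | zero => rfl
  | succ k ih =>
    rw [← add_assoc, run, Function.iterate_succ_apply', ← run, ih, step]
    rw [HaltsWithin] at h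
    simp only [h]

theorem run_eq_of_haltsWithin {M : DTM} {x : List Bool} {t t' : ℕ} (h : M.HaltsWithin x t)
    (h' : M.HaltsWithin x t') : M.run x t = M.run x t' := by
  rcases le_total t t' with hl | hl
  · obtain ⟨k, rfl⟩ := Nat.exists_eq_add_of_le hl
    exact (run_add_of_haltsWithin h k).symm
  · obtain ⟨k, rfl⟩ := Nat.exists_eq_add_of_le hl
    exact run_add_of_haltsWithin h' k

/-- The word at the beginning of a list of cells. -/
def cellWord (r : List (Option Bool)) : List Bool :=
  (r.takeWhile Option.isSome).map fun a => a.getD false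

theorem cellWord_eq {l r : List (Option Bool)} {w : List Bool} (h : TapeReads (Tape.mk₂ l r) w) :
    cellWord r = w := by
  have h' : ∀ i ≤ w.length, r.getI i = w[i]? := fun i hi => by
    rw [← h i hi, Tape.mk₂, Tape.mk'_nth_nat, ListBlank.nth_mk]
  clear h
  induction w generalizing r with
  | nil =>
    have h0 := h' 0 le_rfl
    cases r with
    | nil => rfl
    | cons a r =>
      simp only [List.getI_cons_zero, List.getElem?_nil] at h0
      subst h0
      rfl
  | cons b w ih =>
    have h0 := h' 0 (Nat.zero_le _)
    cases r with
    | nil => simp at h0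
    | cons a r =>
      simp only [List.getI_cons_zero, List.getElem?_cons_zero] at h0
      subst h0
      have := ih (r := r) fun i hi => by
        have := h' (i + 1) (by simpa using hi)
        simpa using this
      rw [cellWord, List.takeWhile_cons_of_pos rfl, List.map_cons, ← cellWord, this]
      rfl

theorem primrec_listStep (M : DTM) [Primcodable M.S] : Primrec M.listStep := by
  have hq : Primrec fun c : M.S × List (Option Bool) × List (Option Bool) => (c.1, c.2.2.headI) :=
    Primrec.fst.pair (Primrec.list_headI.comp (Primrec.snd.comp Primrec.snd))
  have h1 : Primrec fun c : M.S × List (Option Bool) × List (Option Bool) =>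
      (M.δ c.1 c.2.2.headI).1 := (Primrec.dom_finite fun p : M.S × Option Bool => (M.δ p.1 p.2).1).comp hq
  have h2 : Primrec fun c : M.S × List (Option Bool) × List (Option Bool) =>
      (M.δ c.1 c.2.2.headI).2.1 :=
    (Primrec.dom_finite fun p : M.S × Option Bool => (M.δ p.1 p.2).2.1).comp hq
  have hL : Primrec fun c : M.S × List (Option Bool) × List (Option Bool) =>
      (match (M.δ c.1 c.2.2.headI).2.2 with | HeadMove.L => true | _ => false : Bool) :=
    (Primrec.dom_finite fun p : M.S × Option Bool =>
      (match (M.δ p.1 p.2).2.2 with | HeadMove.L => true | _ => false : Bool)).comp hq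
  have hR : Primrec fun c : M.S × List (Option Bool) × List (Option Bool) =>
      (match (M.δ c.1 c.2.2.headI).2.2 with | HeadMove.R => true | _ => false : Bool) :=
    (Primrec.dom_finite fun p : M.S × Option Bool =>
      (match (M.δ p.1 p.2).2.2 with | HeadMove.R => true | _ => false : Bool)).comp hq
  have hl : Primrec fun c : M.S × List (Option Bool) × List (Option Bool) => c.2.1 :=
    Primrec.fst.comp Primrec.snd
  have hr : Primrec fun c : M.S × List (Option Bool) × List (Option Bool) => c.2.2.tail :=
    Primrec.list_tail.comp (Primrec.snd.comp Primrec.snd)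
  have hmain := Primrec.cond ((Primrec.dom_finite M.final).comp Primrec.fst) Primrec.id
    (Primrec.cond hL
      (h1.pair ((Primrec.list_tail.comp hl).pair (Primrec.list_cons.comp
        (Primrec.list_headI.comp hl) (Primrec.list_cons.comp h2 hr))))
      (Primrec.cond hR (h1.pair ((Primrec.list_cons.comp h2 hl).pair hr))
        (h1.pair (hl.pair (Primrec.list_cons.comp h2 hr)))))
  refine hmain.of_eq fun c => ?_
  rw [listStep]
  cases M.final c.1 with
  | true => rfl
  | false =>
    simp only [cond_false, Bool.false_eq_true, if_false]
    cases (M.δ c.1 c.2.2.headI).2.2 <;> rfl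

/-- The output of a machine of polynomial runtime is a primitive recursive function of the input:
simulate the machine for the number of steps given by the polynomial. -/
theorem PolyTime.primrec {M : DTM} (hM : M.PolyTime) {out : List Bool → List Bool}
    (h : ∀ x, M.Outputs x (out x)) : Primrec out := by
  obtain ⟨p, hp⟩ := hM
  let : Primcodable M.S := Primcodable.ofEquiv (Fin (Fintype.card M.S)) (Fintype.equivFin M.S)
  have hcfg : Primrec fun x : List Bool =>
      M.listStep^[p.eval x.length] (M.init, [], x.map some) :=
    Primrec.nat_iterate ((primrec_polynomial_eval p).comp Primrec.list_length)
      ((Primrec.const M.init).pair ((Primrec.const []).pair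
        (Primrec.list_map Primrec.id (Primrec.option_some.comp₂ Primrec₂.right))))
      (M.primrec_listStep.comp₂ Primrec₂.right)
  have hword : Primrec cellWord :=
    Primrec.list_map (Primrec.list_takeWhile Primrec.option_isSome)
      ((Primrec.option_getD.comp Primrec.id (Primrec.const false)).comp₂ Primrec₂.right)
  refine (hword.comp (Primrec.snd.comp (Primrec.snd.comp hcfg))).of_eq fun x => ?_
  obtain ⟨t, ht, hw⟩ := h x
  rw [run_eq_of_haltsWithin ht (hp x), run_eq_listCfg] at hw
  exact cellWord_eq hw

end DTM

/-- Decoding of `wordNum`: split off the last bit while the number exceeds `1`. -/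
def numWordStep (c : ℕ × List Bool) : ℕ × List Bool :=
  if c.1 ≤ 1 then c else (c.1 / 2, decide (c.1 % 2 = 1) :: c.2)

/-- The string with a given number. The number itself bounds the number of iterations needed. -/
def numWord (n : ℕ) : List Bool := (numWordStep^[n] (n, [])).2

theorem wordNum_append_singleton (x : List Bool) (b : Bool) :
    wordNum (x ++ [b]) = 2 * wordNum x + b.toNat :=
  binValue_append_singleton (true :: x) b

theorem length_lt_wordNum (x : List Bool) : x.length < wordNum x := by
  induction x using List.reverseRecOn with
  | nil => simp [wordNum, binValue]
  | append_singleton x b ih =>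
    rw [wordNum_append_singleton, List.length_append, List.length_singleton]
    omega

theorem iterate_numWordStep (x l : List Bool) (k : ℕ) (hk : x.length ≤ k) :
    numWordStep^[k] (wordNum x, l) = (1, x ++ l) := by
  induction x using List.reverseRecOn generalizing k l with
  | nil =>
    have : wordNum [] = 1 := rfl
    rw [this]
    exact Function.iterate_fixed rfl k
  | append_singleton x b ih =>
    rw [List.length_append, List.length_singleton] at hk
    obtain ⟨k, rfl⟩ : ∃ j, k = j + 1 := ⟨k - 1, by omega⟩
    have h1 := length_lt_wordNum x
    have e : numWordStep (wordNum (x ++ [b]), l) = (wordNum x, b :: l) := by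
      rw [numWordStep, if_neg (by rw [wordNum_append_singleton]; simp; omega),
        wordNum_append_singleton]
      cases b
      · simp
      · simp; omega
    rw [Function.iterate_succ_apply, e, ih _ _ (by omega)]
    simp

theorem numWord_wordNum (x : List Bool) : numWord (wordNum x) = x := by
  rw [numWord, iterate_numWordStep x [] _ (length_lt_wordNum x).le]
  simp

theorem primrec_numWord : Primrec numWord := by
  have hstep : Primrec numWordStep :=
    Primrec.ite (Primrec.nat_le.comp Primrec.fst (Primrec.const 1)) Primrec.id
      ((Primrec.nat_div.comp Primrec.fst (Primrec.const 2)).pair (Primrec.list_cons.comp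
        (Primrec.eq.decide.comp (Primrec.nat_mod.comp Primrec.fst (Primrec.const 2))
          (Primrec.const 1)) Primrec.snd))
  exact Primrec.snd.comp (Primrec.nat_iterate Primrec.id (Primrec.id.pair (Primrec.const []))
    (hstep.comp₂ Primrec₂.right))

/-- Promise problems given by disjoint primitive recursive predicates are totally decidable. -/
theorem totallyDecidable_of_primrecPred (A : PromiseProblem) (hy : PrimrecPred fun x => x ∈ A.yes)
    (hn : PrimrecPred fun x => x ∈ A.no) : TotallyDecidable A := by
  classical
  have hf : Primrec fun n : ℕ =>
      if numWord n ∈ A.yes then 1 else if numWord n ∈ A.no then 0 else 2 :=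
    Primrec.ite (hy.comp primrec_numWord) (Primrec.const 1)
      (Primrec.ite (hn.comp primrec_numWord) (Primrec.const 0) (Primrec.const 2))
  obtain ⟨M, hM⟩ := exists_DTM_of_primrec hf
  simp only [numWord_wordNum] at hM
  refine ⟨M, fun x hx => ?_, fun x hx => ?_, fun x hx => ?_⟩
  · have := hM x
    rwa [if_pos hx] at this
  · have := hM x
    rwa [if_neg (Set.disjoint_right.1 A.disj hx), if_pos hx] at this
  · have := hM x
    rwa [if_neg fun h => hx (Or.inl h), if_neg fun h => hx (Or.inr h)] at this

/-! ### Decoding circuits -/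

/-- The lengths of the blocks of ones of a binary word that are separated by its zeros. -/
def runs (w : List Bool) : List ℕ :=
  w.foldr (fun b l => if b then (l.headI + 1) :: l.tail else 0 :: l) [0]

theorem runs_replicate (k : ℕ) : runs (List.replicate k true) = [k] := by
  induction k with
  | zero => rfl
  | succ k ih => rw [List.replicate_succ, runs, List.foldr_cons, ← runs, ih]; rfl

theorem runs_replicate_append (k : ℕ) (w : List Bool) :
    runs (List.replicate k true ++ false :: w) = k :: runs w := by
  induction k with
  | zero => rfl
  | succ k ih =>
    rw [List.replicate_succ, List.cons_append, runs, List.foldr_cons, ← runs, ih]; rfl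

/-- The binary word with three given runs. -/
def tripleWord (t : ℕ × ℕ × ℕ) : List Bool :=
  List.replicate t.1 true ++ false :: (List.replicate t.2.1 true ++
    false :: List.replicate t.2.2 true)

/-- The three runs of the code word of a gate. -/
def Gate.triple : Gate → ℕ × ℕ × ℕ
  | H q => (0, 1, q + 1)
  | T q => (1, 0, q + 1)
  | CNOT c t => (2, c + 1, t + 1)

/-- The gate with given runs; meaningful for triples that satisfy `IsGateTriple`. -/
def gateOfTriple (t : ℕ × ℕ × ℕ) : Gate :=
  if t.1 = 0 then Gate.H (t.2.2 - 1) else if t.1 = 1 then Gate.T (t.2.2 - 1)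
  else Gate.CNOT (t.2.1 - 1) (t.2.2 - 1)

/-- The triple consists of the runs of a well-formed gate. -/
def IsGateTriple (t : ℕ × ℕ × ℕ) : Prop :=
  (t.1 = 0 ∧ t.2.1 = 1 ∧ 0 < t.2.2) ∨ (t.1 = 1 ∧ t.2.1 = 0 ∧ 0 < t.2.2) ∨
    (t.1 = 2 ∧ 0 < t.2.1 ∧ 0 < t.2.2 ∧ ¬ t.2.1 = t.2.2)

theorem tripleWord_triple (g : Gate) : tripleWord g.triple = g.encode := by
  cases g <;> simp [tripleWord, Gate.triple, Gate.encode, List.replicate_succ]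

theorem isGateTriple_triple {g : Gate} (h : g.WellFormed) : IsGateTriple g.triple := by
  cases g <;> simp_all [IsGateTriple, Gate.triple, Gate.WellFormed]

theorem IsGateTriple.triple_eq {t : ℕ × ℕ × ℕ} (h : IsGateTriple t) :
    (gateOfTriple t).triple = t := by
  obtain ⟨a, b, c⟩ := t
  rcases h with ⟨h1, h2, h3⟩ | ⟨h1, h2, h3⟩ | ⟨h1, h2, h3, h4⟩ <;>
    simp only at h1 h2 h3 <;> subst h1 <;> simp [gateOfTriple, Gate.triple] <;> omega

theorem IsGateTriple.wellFormed {t : ℕ × ℕ × ℕ} (h : IsGateTriple t) :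
    (gateOfTriple t).WellFormed := by
  obtain ⟨a, b, c⟩ := t
  rcases h with ⟨h1, h2, h3⟩ | ⟨h1, h2, h3⟩ | ⟨h1, h2, h3, h4⟩ <;>
    simp only at h1 h2 h3 <;> subst h1 <;> simp [gateOfTriple, Gate.WellFormed]
  simp only at h4
  omega

theorem intercalate_eq_tail {α : Type} (a : α) (L : List (List α)) :
    [a].intercalate L = (L.flatMap fun l => a :: l).tail := by
  induction L with
  | nil => rfl
  | cons l L ih =>
    cases L with
    | nil => simp [List.intercalate]
    | cons l' L =>
      have : ([a] : List α).intercalate (l :: l' :: L) = l ++ a :: [a].intercalate (l' :: L) := by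
        simp [List.intercalate]
      rw [this, ih]
      simp

/-- The code word of the circuit whose gates have given runs. -/
def triplesWord (ts : List (ℕ × ℕ × ℕ)) : List Bool :=
  (ts.flatMap fun t => false :: tripleWord t).tail

theorem triplesWord_map (C : List Gate) : triplesWord (C.map Gate.triple) = encodeCircuit C := by
  rw [encodeCircuit, intercalate_eq_tail, triplesWord, List.flatMap_map, List.flatMap_map]
  simp only [tripleWord_triple]

theorem runs_triplesWord (t : ℕ × ℕ × ℕ) (ts : List (ℕ × ℕ × ℕ)) :
    runs (triplesWord (t :: ts)) = (t :: ts).flatMap fun t => [t.1, t.2.1, t.2.2] := by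
  induction ts generalizing t with
  | nil => simp [triplesWord, tripleWord, runs_replicate_append, runs_replicate]
  | cons t' ts ih =>
    have : triplesWord (t :: t' :: ts) = tripleWord t ++ false :: triplesWord (t' :: ts) := by
      simp [triplesWord]
    rw [this, tripleWord, List.append_assoc, List.cons_append, List.append_assoc, List.cons_append,
      runs_replicate_append, runs_replicate_append, runs_replicate_append, ih]
    simp

/-- Cut a list into triples, dropping an incomplete one at the end. -/
def chunks (l : List ℕ) : List (ℕ × ℕ × ℕ) :=
  (List.range (l.length / 3)).map fun i =>
    (l.getD (3 * i) 0, l.getD (3 * i + 1) 0, l.getD (3 * i + 2) 0)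

theorem chunks_flatMap (ts : List (ℕ × ℕ × ℕ)) :
    chunks (ts.flatMap fun t => [t.1, t.2.1, t.2.2]) = ts := by
  induction ts with
  | nil => rfl
  | cons t ts ih =>
    conv_rhs => rw [← ih]
    simp only [List.flatMap_cons, List.cons_append, List.nil_append, chunks, List.length_cons]
    rw [show ∀ n, (n + 1 + 1 + 1) / 3 = n / 3 + 1 by omega, List.range_succ_eq_map,
      List.map_cons, List.map_map]
    rfl

/-- The gates of the circuit with code word `w`, as triples of runs. The value is used only if
`IsCircuitWord w`. -/
def parse (w : List Bool) : List (ℕ × ℕ × ℕ) := chunks (runs w)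

/-- The word `w` is the code word of a circuit. As `parse` does not check the format, the parsed
gates are encoded again and compared with `w`. -/
def IsCircuitWord (w : List Bool) : Prop :=
  (∀ t ∈ parse w, IsGateTriple t) ∧ triplesWord (parse w) = w

theorem parse_encodeCircuit (C : List Gate) : parse (encodeCircuit C) = C.map Gate.triple := by
  rw [← triplesWord_map]
  cases C with
  | nil => rfl
  | cons g C => rw [List.map_cons, parse, runs_triplesWord, chunks_flatMap]

theorem decodeCircuit_of_isCircuitWord {w : List Bool} (h : IsCircuitWord w) :
    decodeCircuit w = some ((parse w).map gateOfTriple) := by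
  have e : encodeCircuit ((parse w).map gateOfTriple) = w := by
    rw [← triplesWord_map, List.map_map]
    conv_rhs => rw [← h.2]
    congr 1
    conv_rhs => rw [← List.map_id (parse w)]
    exact List.map_congr_left fun t ht => (h.1 t ht).triple_eq
  have := decodeCircuit_encodeCircuit ((parse w).map gateOfTriple) fun g hg => by
    obtain ⟨t, ht, rfl⟩ := List.mem_map.1 hg
    exact (h.1 t ht).wellFormed
  rwa [e] at this

theorem decodeCircuit_of_not_isCircuitWord {w : List Bool} (h : ¬ IsCircuitWord w) :
    decodeCircuit w = none := by
  rw [decodeCircuit, dif_neg]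
  rintro ⟨C, hC, rfl⟩
  refine h ⟨fun t ht => ?_, ?_⟩
  · rw [parse_encodeCircuit] at ht
    obtain ⟨g, hg, rfl⟩ := List.mem_map.1 ht
    exact isGateTriple_triple (hC g hg)
  · rw [parse_encodeCircuit, triplesWord_map]

section Primrec

open Primrec

theorem primrec_runs : Primrec runs := by
  have hstep : Primrec₂ fun (_ : List Bool) (p : Bool × List ℕ) =>
      if p.1 = true then (p.2.headI + 1) :: p.2.tail else 0 :: p.2 := by
    refine Primrec.ite ?_ ?_ ?_
    · exact Primrec.eq.comp (fst.comp snd) (const true)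
    · exact list_cons.comp (succ.comp (list_headI.comp (snd.comp snd)))
        (list_tail.comp (snd.comp snd))
    · exact list_cons.comp (const 0) (snd.comp snd)
  exact list_foldr Primrec.id (const [0]) hstep

theorem primrec_replicate : Primrec fun k : ℕ => List.replicate k true :=
  (list_map list_range (Primrec₂.const true)).of_eq fun k => by
    rw [List.map_const', List.length_range]

theorem primrec_tripleWord : Primrec tripleWord :=
  list_append.comp (primrec_replicate.comp fst) (list_cons.comp (const false)
    (list_append.comp (primrec_replicate.comp (fst.comp snd)) (list_cons.comp (const false)
      (primrec_replicate.comp (snd.comp snd)))))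

theorem primrec_triplesWord : Primrec triplesWord :=
  list_tail.comp (list_flatMap Primrec.id
    ((list_cons.comp (const false) primrec_tripleWord).comp₂ Primrec₂.right))

theorem primrec_parse : Primrec parse := by
  have hget : ∀ k, Primrec fun p : List ℕ × ℕ => p.1.getD (3 * p.2 + k) 0 := fun k =>
    (list_getD 0).comp fst (nat_add.comp (nat_mul.comp (const 3) snd) (const k))
  have hg : Primrec₂ fun (l : List ℕ) (i : ℕ) =>
      (l.getD (3 * i) 0, l.getD (3 * i + 1) 0, l.getD (3 * i + 2) 0) :=
    (hget 0).pair ((hget 1).pair (hget 2))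
  exact (list_map (list_range.comp (nat_div.comp list_length (const 3))) hg).comp primrec_runs

theorem primrecPred_isGateTriple : PrimrecPred IsGateTriple := by
  have h1 : Primrec fun t : ℕ × ℕ × ℕ => t.1 := fst
  have h2 : Primrec fun t : ℕ × ℕ × ℕ => t.2.1 := fst.comp snd
  have h3 : Primrec fun t : ℕ × ℕ × ℕ => t.2.2 := snd.comp snd
  have h3' := nat_lt.comp (const 0) h3
  exact ((Primrec.eq.comp h1 (const 0)).and ((Primrec.eq.comp h2 (const 1)).and h3')).or
    (((Primrec.eq.comp h1 (const 1)).and ((Primrec.eq.comp h2 (const 0)).and h3')).or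
      ((Primrec.eq.comp h1 (const 2)).and ((nat_lt.comp (const 0) h2).and
        (h3'.and (Primrec.eq.comp h2 h3).not))))

theorem primrecPred_isCircuitWord : PrimrecPred IsCircuitWord :=
  (primrecPred_isGateTriple.forall_mem_list.comp primrec_parse).and
    (Primrec.eq.comp (primrec_triplesWord.comp primrec_parse) Primrec.id)

end Primrec

/-! ### Exact arithmetic with eighth roots of unity -/

/-- The primitive eighth root of unity `exp (iπ/4)`. -/
noncomputable def zeta : ℂ := Complex.exp (Complex.I * ((Real.pi / 4 : ℝ) : ℂ))

/-- A formal sum of terms `ζ ^ i * X ^ j`, given as the list of the pairs `(i, j)`.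
Integer coefficients are expressed by repetition of terms and by `ζ ^ 4 = -1`. -/
abbrev CycSum : Type := List (ℕ × ℕ)

namespace CycSum

open Polynomial

/-- The polynomial given by a formal sum. -/
noncomputable def val (L : CycSum) : ℂ[X] :=
  (L.map fun e => monomial e.2 (zeta ^ e.1)).sum

/-- The product of formal sums. -/
def mul (L L' : CycSum) : CycSum := L.flatMap fun a => L'.map fun b => (a.1 + b.1, a.2 + b.2)

/-- The formal sum with complex conjugate coefficients: the conjugate of `ζ` is `ζ ^ 7`. -/
def conj (L : CycSum) : CycSum := L.map fun e => (7 * e.1, e.2)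

/-- The formal sum `n * ζ ^ i`. -/
def nat (n i : ℕ) : CycSum := (List.range n).map fun _ => (i, 0)

/-- A sum of formal sums. -/
def sum (n : ℕ) (f : ℕ → CycSum) : CycSum := (List.range n).flatMap f

/-- A product of formal sums. -/
def prod (n : ℕ) (f : ℕ → CycSum) : CycSum :=
  (List.range n).foldl (fun L i => mul L (f i)) [(0, 0)]

@[simp] theorem val_nil : val [] = 0 := rfl

theorem val_cons (e : ℕ × ℕ) (L : CycSum) : val (e :: L) = monomial e.2 (zeta ^ e.1) + val L := by
  simp [val]

@[simp] theorem val_one : val [(0, 0)] = 1 := by simp [val_cons]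

theorem val_append (L L' : CycSum) : val (L ++ L') = val L + val L' := by simp [val]

theorem val_mul (L L' : CycSum) : val (mul L L') = val L * val L' := by
  induction L with
  | nil => simp [mul]
  | cons a L ih =>
    have h : val (L'.map fun b => (a.1 + b.1, a.2 + b.2)) = monomial a.2 (zeta ^ a.1) * val L' := by
      clear ih
      induction L' with
      | nil => simp
      | cons b L' ih =>
        rw [List.map_cons, val_cons, ih, val_cons, mul_add, monomial_mul_monomial, pow_add]
    rw [mul, List.flatMap_cons, val_append, h, ← mul, ih, val_cons, add_mul]

theorem val_nat (n i : ℕ) : val (nat n i) = C (n * zeta ^ i) := by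
  simp [val, nat, ← C_mul_X_pow_eq_monomial]

theorem val_sum (n : ℕ) (f : ℕ → CycSum) : val (sum n f) = ∑ i ∈ Finset.range n, val (f i) := by
  induction n with
  | zero => rfl
  | succ n ih =>
    rw [sum, List.range_succ, List.flatMap_append, val_append, ← sum, ih, Finset.sum_range_succ]
    simp

theorem val_prod (n : ℕ) (f : ℕ → CycSum) : val (prod n f) = ∏ i ∈ Finset.range n, val (f i) := by
  induction n with
  | zero => simp [prod]
  | succ n ih =>
    rw [prod, List.range_succ, List.foldl_append, ← prod, Finset.prod_range_succ, ← ih]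
    simp [val_mul]

theorem zeta_sq : zeta ^ 2 = Complex.I := by
  rw [zeta, ← Complex.exp_nat_mul]
  convert Complex.exp_pi_div_two_mul_I using 2
  push_cast; ring

theorem zeta_eq : zeta = (1 + Complex.I) / (Real.sqrt 2 : ℝ) := by
  have h : (Real.sqrt 2 : ℝ) / 2 = 1 / Real.sqrt 2 := by
    rw [div_eq_div_iff (by norm_num) (by positivity), Real.mul_self_sqrt (by norm_num)]; norm_num
  have e : zeta = ((Real.cos (Real.pi / 4) : ℝ) : ℂ) + ((Real.sin (Real.pi / 4) : ℝ) : ℂ) * Complex.I := by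
    rw [Complex.ofReal_cos, Complex.ofReal_sin, ← Complex.exp_mul_I, zeta, mul_comm]
  rw [e, Real.cos_pi_div_four, Real.sin_pi_div_four, h]
  push_cast; ring

theorem zeta_pow_four : zeta ^ 4 = -1 := by
  rw [show 4 = 2 * 2 from rfl, pow_mul, zeta_sq, Complex.I_sq]

theorem zeta_pow_eight : zeta ^ 8 = 1 := by
  rw [show 8 = 4 * 2 from rfl, pow_mul, zeta_pow_four]; norm_num

theorem conj_zeta : (starRingEnd ℂ) zeta = zeta ^ 7 := by
  have h : (starRingEnd ℂ) zeta * zeta = 1 := by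
    rw [zeta, ← Complex.exp_conj, ← Complex.exp_add, map_mul, Complex.conj_I,
      Complex.conj_ofReal, neg_mul, neg_add_cancel, Complex.exp_zero]
  calc (starRingEnd ℂ) zeta = (starRingEnd ℂ) zeta * zeta ^ 8 := by rw [zeta_pow_eight, mul_one]
    _ = (starRingEnd ℂ) zeta * zeta * zeta ^ 7 := by ring
    _ = zeta ^ 7 := by rw [h, one_mul]

theorem val_conj (L : CycSum) : val (conj L) = (val L).map (starRingEnd ℂ) := by
  induction L with
  | nil => simp [conj]
  | cons e L ih =>
    rw [conj, List.map_cons, val_cons, ← conj, ih, val_cons, Polynomial.map_add, map_monomial,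
      map_pow (starRingEnd ℂ), conj_zeta, ← pow_mul]

theorem sqrt_two_mul_sqrt_two : ((Real.sqrt 2 : ℝ) : ℂ) * ((Real.sqrt 2 : ℝ) : ℂ) = 2 := by
  rw [← Complex.ofReal_mul, Real.mul_self_sqrt (by norm_num)]; norm_num

theorem sqrt_two_ne_zero : ((Real.sqrt 2 : ℝ) : ℂ) ≠ 0 := by
  rw [Ne, Complex.ofReal_eq_zero]; positivity

theorem zeta_add_zeta_pow_seven : zeta + zeta ^ 7 = (Real.sqrt 2 : ℝ) := by
  rw [← conj_zeta, Complex.add_conj]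
  have : zeta.re = 1 / Real.sqrt 2 := by
    rw [zeta_eq, Complex.div_ofReal_re]; simp
  rw [this, Complex.ofReal_inj, mul_one_div, div_eq_iff (by positivity),
    Real.mul_self_sqrt (by norm_num)]

theorem one_add_zeta_sq : 1 + zeta ^ 2 = (Real.sqrt 2 : ℝ) * zeta := by
  rw [← zeta_add_zeta_pow_seven, add_mul, ← pow_succ, zeta_pow_eight]; ring

/-! ### The sign of the real part of a coefficient -/

/-- The number of terms `ζ ^ i * X ^ k` of a formal sum with `i` congruent to `r` modulo `8`. -/
def count (L : CycSum) (k r : ℕ) : ℕ := (L.filter fun e => e.2 = k ∧ e.1 % 8 = r).length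

/-- The inequality `√2 a + b ≤ √2 c + d` for natural numbers; the differences are truncated.
Writing it as `b - d ≤ √2 (c - a)`, the first alternative is the case of a nonnegative right-hand
side; the second one is the case where both sides are nonpositive. -/
def SqrtLe (a b c d : ℕ) : Prop :=
  (a ≤ c ∧ (b - d) * (b - d) ≤ 2 * ((c - a) * (c - a))) ∨
    (b ≤ d ∧ 2 * ((a - c) * (a - c)) ≤ (d - b) * (d - b))

theorem sqrtLe_iff (a b c d : ℕ) :
    SqrtLe a b c d ↔ Real.sqrt 2 * a + b ≤ Real.sqrt 2 * c + d := by
  have key : ∀ x y : ℕ, 2 * (x * x) ≤ y * y ↔ Real.sqrt 2 * x ≤ y := by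
    intro x y
    have h : (Real.sqrt 2 * x) ^ 2 = 2 * (x * x) := by
      rw [mul_pow, Real.sq_sqrt (by norm_num)]; ring
    rw [← abs_of_nonneg (show (0:ℝ) ≤ Real.sqrt 2 * x by positivity),
      ← abs_of_nonneg (show (0:ℝ) ≤ y by positivity), ← sq_le_sq, h]
    rw [sq]
    norm_cast
  have key' : ∀ x y : ℕ, y * y ≤ 2 * (x * x) ↔ (y : ℝ) ≤ Real.sqrt 2 * x := by
    intro x y
    have h : (Real.sqrt 2 * x) ^ 2 = 2 * (x * x) := by
      rw [mul_pow, Real.sq_sqrt (by norm_num)]; ring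
    rw [← abs_of_nonneg (show (0:ℝ) ≤ Real.sqrt 2 * x by positivity),
      ← abs_of_nonneg (show (0:ℝ) ≤ y by positivity), ← sq_le_sq, h]
    rw [sq]
    norm_cast
  have hs : 0 < Real.sqrt 2 := by positivity
  rw [SqrtLe, key, key']
  rcases le_or_gt a c with hac | hac
  · obtain ⟨x, rfl⟩ := Nat.exists_eq_add_of_le hac
    rcases le_or_gt b d with hbd | hbd
    · obtain ⟨y, rfl⟩ := Nat.exists_eq_add_of_le hbd
      have e : Real.sqrt 2 * ((a + x : ℕ) : ℝ) = Real.sqrt 2 * a + Real.sqrt 2 * x := by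
        push_cast; ring
      rw [e]
      simp only [Nat.le_add_right, true_and, Nat.sub_eq_zero_of_le, Nat.cast_zero, mul_zero,
        Nat.cast_nonneg, or_true, true_iff, Nat.cast_add]
      have : (0:ℝ) ≤ Real.sqrt 2 * x := by positivity
      have : (0:ℝ) ≤ y := by positivity
      linarith
    · obtain ⟨y, rfl⟩ := Nat.exists_eq_add_of_lt hbd
      have e : Real.sqrt 2 * ((a + x : ℕ) : ℝ) = Real.sqrt 2 * a + Real.sqrt 2 * x := by
        push_cast; ring
      rw [e, show d + y + 1 - d = y + 1 by omega, show a + x - a = x by omega]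
      have h1 : ¬ d + y + 1 ≤ d := by omega
      simp only [Nat.le_add_right, true_and, h1, false_and, or_false]
      push_cast
      constructor <;> intro h <;> linarith
  · obtain ⟨x, rfl⟩ := Nat.exists_eq_add_of_lt hac
    have h1 : ¬ c + x + 1 ≤ c := by omega
    have e : Real.sqrt 2 * ((c + x + 1 : ℕ) : ℝ) = Real.sqrt 2 * c + Real.sqrt 2 * (x + 1 : ℕ) := by
      push_cast; ring
    rw [e, show c + x + 1 - c = x + 1 by omega]
    simp only [h1, false_and, false_or]
    rcases le_or_gt b d with hbd | hbd
    · obtain ⟨y, rfl⟩ := Nat.exists_eq_add_of_le hbd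
      rw [show b + y - b = y by omega]
      simp only [Nat.le_add_right, true_and]
      push_cast
      constructor <;> intro h <;> linarith
    · have h2 : ¬ b ≤ d := by omega
      simp only [h2, false_and, false_iff, not_le]
      have h3 : (d : ℝ) < b := by exact_mod_cast hbd
      have : (0:ℝ) ≤ Real.sqrt 2 * (x + 1 : ℕ) := by positivity
      linarith

/-- After multiplication by `√2`, the real parts `0`, `±1`, `±1/√2` of the powers of `ζ` lie in
`ℤ + √2 ℤ`. -/
theorem re_zeta_pow (i : ℕ) : Real.sqrt 2 * (zeta ^ i).re =
    Real.sqrt 2 * (if i % 8 = 0 then 1 else 0) - Real.sqrt 2 * (if i % 8 = 4 then 1 else 0) +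
    ((if i % 8 = 1 then 1 else 0) + (if i % 8 = 7 then 1 else 0)) -
    ((if i % 8 = 3 then 1 else 0) + (if i % 8 = 5 then 1 else 0)) := by
  have hr : zeta.re = 1 / Real.sqrt 2 := by rw [zeta_eq, Complex.div_ofReal_re]; simp
  have hi : zeta.im = 1 / Real.sqrt 2 := by rw [zeta_eq, Complex.div_ofReal_im]; simp
  have hs : Real.sqrt 2 ≠ 0 := by positivity
  have e : zeta ^ i = zeta ^ (i % 8) := by
    conv_lhs => rw [← Nat.div_add_mod i 8, pow_add, pow_mul, zeta_pow_eight, one_pow, one_mul]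
  rw [e]
  have hlt : i % 8 < 8 := Nat.mod_lt _ (by norm_num)
  have z3 : zeta ^ 3 = zeta * Complex.I := by rw [← zeta_sq]; ring
  have z5 : zeta ^ 5 = -zeta := by rw [pow_succ, zeta_pow_four]; ring
  have z6 : zeta ^ 6 = -Complex.I := by rw [← zeta_sq, show 6 = 4 + 2 from rfl, pow_add, zeta_pow_four]; ring
  have z7 : zeta ^ 7 = -(zeta * Complex.I) := by rw [← z3, show 7 = 4 + 3 from rfl, pow_add, zeta_pow_four]; ring
  interval_cases i % 8 <;>
    simp [zeta_sq, zeta_pow_four, z3, z5, z6, z7, hr, hi, hs]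

theorem re_coeff_val (L : CycSum) (k : ℕ) : Real.sqrt 2 * ((val L).coeff k).re =
    (Real.sqrt 2 * count L k 0 + (count L k 1 + count L k 7 : ℕ)) -
    (Real.sqrt 2 * count L k 4 + (count L k 3 + count L k 5 : ℕ)) := by
  induction L with
  | nil => simp [count]
  | cons e L ih =>
    have hc : ∀ r, (count (e :: L) k r : ℝ) =
        (if e.2 = k then (if e.1 % 8 = r then 1 else 0) else 0) + count L k r := by
      intro r
      by_cases h1 : e.2 = k <;> by_cases h2 : e.1 % 8 = r <;> simp [count, h1, h2, add_comm]
    rw [val_cons, coeff_add, Complex.add_re, mul_add, ih, coeff_monomial]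
    push_cast
    simp only [hc]
    by_cases h : e.2 = k
    · simp only [h, if_true]
      rw [re_zeta_pow]
      ring
    · simp [h]

/-- The real part of the coefficient of `X ^ k` is nonnegative. -/
def NonnegAt (L : CycSum) (k : ℕ) : Prop :=
  SqrtLe (count L k 4) (count L k 3 + count L k 5) (count L k 0) (count L k 1 + count L k 7)

/-- The real part of the coefficient of `X ^ k` is positive. -/
def PosAt (L : CycSum) (k : ℕ) : Prop :=
  ¬ SqrtLe (count L k 0) (count L k 1 + count L k 7) (count L k 4) (count L k 3 + count L k 5)

theorem nonnegAt_iff (L : CycSum) (k : ℕ) : NonnegAt L k ↔ 0 ≤ ((val L).coeff k).re := by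
  have h := re_coeff_val L k
  have hs : 0 < Real.sqrt 2 := by positivity
  rw [NonnegAt, sqrtLe_iff, ← sub_nonneg, ← h, mul_nonneg_iff_of_pos_left hs]

theorem posAt_iff (L : CycSum) (k : ℕ) : PosAt L k ↔ 0 < ((val L).coeff k).re := by
  have h := re_coeff_val L k
  have hs : 0 < Real.sqrt 2 := by positivity
  rw [PosAt, sqrtLe_iff, not_le, ← sub_pos, ← h, mul_pos_iff_of_pos_left hs]

section Primrec

open Primrec

variable {α : Type} [Primcodable α]

theorem primrec_mul : Primrec₂ mul :=
  list_flatMap fst (list_map (snd.comp fst)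
    (pair (nat_add.comp (fst.comp (snd.comp fst)) (fst.comp snd))
      (nat_add.comp (snd.comp (snd.comp fst)) (snd.comp snd)) : Primrec _))

theorem primrec_conj : Primrec conj :=
  list_map Primrec.id ((pair (nat_mul.comp (const 7) fst) snd).comp₂ Primrec₂.right)

theorem primrec_nat : Primrec₂ nat :=
  list_map (list_range.comp fst) (pair (snd.comp fst) (const 0) : Primrec _)

theorem primrec_sum {n : α → ℕ} {f : α → ℕ → CycSum} (hn : Primrec n) (hf : Primrec₂ f) :
    Primrec fun a => sum (n a) (f a) :=
  list_flatMap (list_range.comp hn) hf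

theorem primrec_prod {n : α → ℕ} {f : α → ℕ → CycSum} (hn : Primrec n) (hf : Primrec₂ f) :
    Primrec fun a => prod (n a) (f a) :=
  list_foldl (h := fun a p => mul p.1 (f a p.2)) (list_range.comp hn) (const _)
    (primrec_mul.comp (fst.comp snd) (hf.comp fst (snd.comp snd)))

theorem primrec_count {L : α → CycSum} {k : α → ℕ} (hL : Primrec L) (hk : Primrec k) (r : ℕ) :
    Primrec fun a => count (L a) (k a) r := by
  have h : PrimrecRel fun (e : ℕ × ℕ) (k : ℕ) => e.2 = k ∧ e.1 % 8 = r :=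
    (Primrec.eq.comp (snd.comp fst) snd).and
      (Primrec.eq.comp (nat_mod.comp (fst.comp fst) (const 8)) (const r))
  exact list_length.comp (h.listFilter.comp hL hk)

theorem primrecPred_sqrtLe {a b c d : α → ℕ} (ha : Primrec a) (hb : Primrec b) (hc : Primrec c)
    (hd : Primrec d) : PrimrecPred fun x => SqrtLe (a x) (b x) (c x) (d x) := by
  have sq : ∀ {f g : α → ℕ}, Primrec f → Primrec g →
      Primrec fun x => (f x - g x) * (f x - g x) := fun hf hg =>
    nat_mul.comp (nat_sub.comp hf hg) (nat_sub.comp hf hg)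
  exact ((nat_le.comp ha hc).and
      (nat_le.comp (sq hb hd) (nat_mul.comp (const 2) (sq hc ha)))).or
    ((nat_le.comp hb hd).and (nat_le.comp (nat_mul.comp (const 2) (sq ha hc)) (sq hd hb)))

theorem primrecPred_nonnegAt {L : α → CycSum} {k : α → ℕ} (hL : Primrec L) (hk : Primrec k) :
    PrimrecPred fun a => NonnegAt (L a) (k a) :=
  primrecPred_sqrtLe (primrec_count hL hk 4)
    (nat_add.comp (primrec_count hL hk 3) (primrec_count hL hk 5)) (primrec_count hL hk 0)
    (nat_add.comp (primrec_count hL hk 1) (primrec_count hL hk 7))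

theorem primrecPred_posAt {L : α → CycSum} {k : α → ℕ} (hL : Primrec L) (hk : Primrec k) :
    PrimrecPred fun a => PosAt (L a) (k a) :=
  (primrecPred_sqrtLe (primrec_count hL hk 0)
    (nat_add.comp (primrec_count hL hk 1) (primrec_count hL hk 7)) (primrec_count hL hk 4)
    (nat_add.comp (primrec_count hL hk 3) (primrec_count hL hk 5))).not

end Primrec
end CycSum

/-! ### Exact computation of the acceptance operator -/

/-- The `i`-th digit of `x` in base `N`. -/
def digit (N x i : ℕ) : ℕ := x / N ^ i % N

theorem digit_two_lt (x i : ℕ) : digit 2 x i < 2 := Nat.mod_lt _ two_pos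

/-- The basis state of `n` qubits given by the binary digits of `a`. -/
def toBasis (n a : ℕ) : Basis n := fun j => ⟨digit 2 a j, digit_two_lt a j⟩

theorem bit_toBasis {n a : ℕ} (ha : a < 2 ^ n) (q : ℕ) :
    bit (toBasis n a) q = ⟨digit 2 a q, digit_two_lt a q⟩ := by
  by_cases h : q < n
  · simp [bit, h, toBasis]
  · have : a < 2 ^ q := ha.trans_le (Nat.pow_le_pow_right two_pos (not_lt.1 h))
    simp [bit, h, digit, Nat.div_eq_of_lt this]

theorem toBasis_eq {n a : ℕ} (ha : a < 2 ^ n) : toBasis n a = finFunctionFinEquiv.symm ⟨a, ha⟩ := by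
  funext j
  rfl

theorem sum_basis {M : Type*} [AddCommMonoid M] (n : ℕ) (f : Basis n → M) :
    ∑ c, f c = ∑ i ∈ Finset.range (2 ^ n), f (toBasis n i) := by
  rw [Finset.sum_range]
  refine Fintype.sum_equiv finFunctionFinEquiv _ _ fun c => ?_
  rw [toBasis_eq (Fin.is_lt _)]
  exact congrArg f (finFunctionFinEquiv.symm_apply_apply c).symm

/-- The binary digits of `a` and `b` below `n` agree, except possibly at `q` and `r`. For a single
exception take `q = r`, and for none `q = r = n`. -/
def Agree (n a b q r : ℕ) : Prop :=
  ∀ j < n, j = q ∨ j = r ∨ digit 2 a j = digit 2 b j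

instance (n a b q r : ℕ) : Decidable (Agree n a b q r) := by unfold Agree; infer_instance

theorem agree_iff (n a b q r : ℕ) : Agree n a b q r ↔
    ∀ j : Fin n, (j : ℕ) ≠ q → (j : ℕ) ≠ r → toBasis n a j = toBasis n b j := by
  simp only [Agree, toBasis, Fin.forall_iff]
  grind

theorem agree_iff' (n a b q : ℕ) : Agree n a b q q ↔
    ∀ j : Fin n, (j : ℕ) ≠ q → toBasis n a j = toBasis n b j := by
  rw [agree_iff]
  exact ⟨fun h j hj => h j hj hj, fun h j hj _ => h j hj⟩

/-- The matrix entry of `√2` times a gate between two basis states. The factor clears the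
denominator of the Hadamard gate; for the other gates it is expressed by `√2 = ζ + ζ ^ 7` and
`√2 ζ = 1 + ζ ^ 2`. -/
def gateEntry (t : ℕ × ℕ × ℕ) (n a b : ℕ) : CycSum :=
  if t.1 = 0 then
    if Agree n a b (t.2.2 - 1) (t.2.2 - 1) then
      if digit 2 a (t.2.2 - 1) = 1 ∧ digit 2 b (t.2.2 - 1) = 1 then [(4, 0)] else [(0, 0)]
    else []
  else if t.1 = 1 then
    if Agree n a b (t.2.2 - 1) (t.2.2 - 1) ∧ digit 2 a (t.2.2 - 1) = digit 2 b (t.2.2 - 1) then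
      if digit 2 a (t.2.2 - 1) = 1 then [(0, 0), (2, 0)] else [(1, 0), (7, 0)]
    else []
  else if Agree n a b (t.2.1 - 1) (t.2.2 - 1) ∧
      digit 2 a (t.2.1 - 1) = digit 2 b (t.2.1 - 1) ∧
      digit 2 a (t.2.2 - 1) = (digit 2 b (t.2.1 - 1) + digit 2 b (t.2.2 - 1)) % 2 then
    [(1, 0), (7, 0)]
  else []

open Polynomial CycSum

theorem val_sqrt_two : val [(1, 0), (7, 0)] = C ((Real.sqrt 2 : ℝ) : ℂ) := by
  simp only [val_cons, val_nil, add_zero, monomial_zero_left, pow_one]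
  rw [← C_add, zeta_add_zeta_pow_seven]

theorem val_neg_one : val [(4, 0)] = C (-1) := by
  simp only [val_cons, val_nil, add_zero, monomial_zero_left, zeta_pow_four]

theorem sqrt_two_mul_hMat (i j : Fin 2) :
    ((Real.sqrt 2 : ℝ) : ℂ) * hMat i j = if i = 1 ∧ j = 1 then -1 else 1 := by
  have h := sqrt_two_ne_zero
  fin_cases i <;> fin_cases j <;> simp [hMat]

theorem val_gateEntry (t : ℕ × ℕ × ℕ) {n a b : ℕ} (ha : a < 2 ^ n) (hb : b < 2 ^ n) :
    val (gateEntry t n a b) =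
      C (((Real.sqrt 2 : ℝ) : ℂ) * (gateOfTriple t).op n (toBasis n a) (toBasis n b)) := by
  unfold gateEntry gateOfTriple
  split_ifs with h1 h2 h3 h2 h3 h4 h3
  all_goals simp only [Gate.op, onQubit, onQubits, Matrix.of_apply, ← agree_iff', ← agree_iff,
    bit_toBasis ha, bit_toBasis hb]
  · rw [if_pos h2, sqrt_two_mul_hMat, if_pos (by simpa [Fin.ext_iff] using h3), val_neg_one]
  · rw [if_pos h2, sqrt_two_mul_hMat, if_neg (by simpa [Fin.ext_iff] using h3), val_one, C_1]
  · rw [if_neg h2, mul_zero, C_0, val_nil]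
  · have e : (⟨digit 2 b (t.2.2 - 1), digit_two_lt _ _⟩ : Fin 2) = 1 := by
      exact Fin.ext (h3.2.symm.trans h4)
    have e' : (⟨digit 2 a (t.2.2 - 1), digit_two_lt _ _⟩ : Fin 2) = 1 := Fin.ext h4
    rw [if_pos h3.1, e, e']
    simp only [val_cons, val_nil, add_zero, monomial_zero_left, pow_zero]
    rw [← C_add, one_add_zeta_sq]
    rfl
  · have hlt := digit_two_lt a (t.2.2 - 1)
    have h0 : digit 2 a (t.2.2 - 1) = 0 := by omega
    have e : (⟨digit 2 b (t.2.2 - 1), digit_two_lt _ _⟩ : Fin 2) = 0 := by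
      exact Fin.ext (h3.2.symm.trans h0)
    have e' : (⟨digit 2 a (t.2.2 - 1), digit_two_lt _ _⟩ : Fin 2) = 0 := Fin.ext h0
    rw [if_pos h3.1, e, e', val_sqrt_two]
    simp [tMat]
  · by_cases h4 : Agree n a b (t.2.2 - 1) (t.2.2 - 1)
    · have h5 : digit 2 a (t.2.2 - 1) ≠ digit 2 b (t.2.2 - 1) := fun h => h3 ⟨h4, h⟩
      have hz : ∀ i j : Fin 2, (i : ℕ) ≠ j → tMat i j = 0 := by
        intro i j hij
        fin_cases i <;> fin_cases j <;> simp [tMat] at hij ⊢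
      rw [if_pos h4, hz _ _ h5, mul_zero, C_0, val_nil]
    · rw [if_neg h4, mul_zero, C_0, val_nil]
  · rw [if_pos h3.1, val_sqrt_two, cnotMat, Matrix.of_apply, if_pos, mul_one]
    refine ⟨Fin.ext h3.2.1, Fin.ext ?_⟩
    rw [Fin.val_add]
    exact h3.2.2
  · by_cases h4 : Agree n a b (t.2.1 - 1) (t.2.2 - 1)
    · rw [if_pos h4, cnotMat, Matrix.of_apply, if_neg, mul_zero, C_0, val_nil]
      rintro ⟨h5, h6⟩
      refine h3 ⟨h4, congrArg Fin.val h5, ?_⟩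
      have := congrArg Fin.val h6
      rwa [Fin.val_add] at this
    · rw [if_neg h4, mul_zero, C_0, val_nil]

/-- The effect of one gate on a vector of amplitudes. -/
def applyGate (n : ℕ) (v : List CycSum) (t : ℕ × ℕ × ℕ) : List CycSum :=
  (List.range (2 ^ n)).map fun a =>
    CycSum.sum (2 ^ n) fun c => mul (gateEntry t n a c) (v.getD c [])

/-- The amplitudes after running the circuit on a basis state, scaled by `√2` for each gate. -/
def column (n : ℕ) (ts : List (ℕ × ℕ × ℕ)) (j : ℕ) : List CycSum :=
  ts.foldl (applyGate n)
    ((List.range (2 ^ n)).map fun a => if Agree n a j n n then [(0, 0)] else [])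

theorem getD_map_range (N : ℕ) (f : ℕ → CycSum) {a : ℕ} (ha : a < N) :
    ((List.range N).map f).getD a [] = f a := by
  rw [List.getD_eq_getElem _ _ (by simpa using ha)]
  simp

theorem val_foldl_applyGate {n : ℕ} (ts : List (ℕ × ℕ × ℕ)) (v : List CycSum) (U : Op n) (s : ℂ)
    (y : Basis n) (hv : ∀ a < 2 ^ n, val (v.getD a []) = C (s * U (toBasis n a) y)) {a : ℕ}
    (ha : a < 2 ^ n) :
    val ((ts.foldl (applyGate n) v).getD a []) =
      C (s * ((Real.sqrt 2 : ℝ) : ℂ) ^ ts.length *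
        ((ts.map gateOfTriple).foldl (fun U g => g.op n * U) U) (toBasis n a) y) := by
  induction ts generalizing v U s with
  | nil => simpa using hv a ha
  | cons t ts ih =>
    rw [List.foldl_cons, List.map_cons, List.foldl_cons, List.length_cons]
    rw [ih (applyGate n v t) ((gateOfTriple t).op n * U) (s * ((Real.sqrt 2 : ℝ) : ℂ))]
    · rw [pow_succ']; ring_nf
    · intro b hb
      rw [applyGate, getD_map_range _ _ hb, CycSum.val_sum, Matrix.mul_apply, sum_basis,
        Finset.mul_sum, map_sum]
      refine Finset.sum_congr rfl fun c hc => ?_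
      rw [val_mul, val_gateEntry t hb (Finset.mem_range.1 hc), hv c (Finset.mem_range.1 hc),
        ← C_mul]
      congr 1
      ring

theorem val_column {n : ℕ} (ts : List (ℕ × ℕ × ℕ)) {a : ℕ} (j : ℕ) (ha : a < 2 ^ n) :
    val ((column n ts j).getD a []) = C (((Real.sqrt 2 : ℝ) : ℂ) ^ ts.length *
        circuitOp n (ts.map gateOfTriple) (toBasis n a) (toBasis n j)) := by
  have h := val_foldl_applyGate ts (U := (1 : Op n)) (s := 1) (y := toBasis n j)
    (v := (List.range (2 ^ n)).map fun a => if Agree n a j n n then [(0, 0)] else [])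
    (hv := fun b hb => ?_) ha
  · rw [one_mul] at h
    exact h
  · rw [getD_map_range _ _ hb, Matrix.one_apply, one_mul]
    have e : toBasis n b = toBasis n j ↔ Agree n b j n n := by
      rw [agree_iff', funext_iff]
      exact ⟨fun h j _ => h j, fun h j => h j (Fin.is_lt j).ne⟩
    by_cases h : Agree n b j n n
    · rw [if_pos h, if_pos (e.2 h), val_one, C_1]
    · rw [if_neg h, if_neg (mt e.1 h), val_nil, C_0]

/-- The number of qubits of a circuit with `m` witness qubits. -/
def numQubits (m : ℕ) (ts : List (ℕ × ℕ × ℕ)) : ℕ := m + ancillas m (ts.map gateOfTriple)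

/-- An entry of the acceptance operator on the witness qubits, scaled by `2` for each gate: the
unitary and its adjoint contribute a factor `√2` each. The ancillas are initially `0`, so the columns
of the unitary that matter are those numbered like the witness basis states. -/
def accEntry (m : ℕ) (ts : List (ℕ × ℕ × ℕ)) (i j : ℕ) : CycSum :=
  CycSum.sum (2 ^ numQubits m ts) fun b =>
    if digit 2 b 0 = 1 then
      mul (conj ((column (numQubits m ts) ts i).getD b []))
        ((column (numQubits m ts) ts j).getD b [])
    else []

theorem append_toBasis {m i : ℕ} (k : ℕ) (hi : i < 2 ^ m) :
    Fin.append (toBasis m i) 0 = toBasis (m + k) i := by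
  funext j
  refine Fin.addCases (fun j => ?_) (fun j => ?_) j
  · rw [Fin.append_left]; rfl
  · rw [Fin.append_right]
    have : i < 2 ^ (m + j.1) := hi.trans_le (Nat.pow_le_pow_right two_pos (Nat.le_add_right _ _))
    simp [toBasis, digit, Nat.div_eq_of_lt this]

open scoped Matrix in
theorem val_accEntry (m : ℕ) (ts : List (ℕ × ℕ × ℕ)) {w : List Bool}
    (hw : decodeCircuit w = some (ts.map gateOfTriple)) {i j : ℕ} (hi : i < 2 ^ m)
    (hj : j < 2 ^ m) :
    val (accEntry m ts i j) = C (2 ^ ts.length * accOp m w (toBasis m i) (toBasis m j)) := by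
  rw [accEntry, numQubits, CycSum.val_sum, accOp, hw]
  simp only [Matrix.submatrix_apply, append_toBasis _ hi, append_toBasis _ hj]
  have h0 : 0 < m + ancillas m (ts.map gateOfTriple) := by
    have : ∀ l : List ℕ, 1 ≤ l.foldr max 1 := by
      intro l
      induction l with
      | nil => exact le_rfl
      | cons a l ih => exact ih.trans (le_max_right _ _)
    have := this (((ts.map gateOfTriple)).map Gate.width)
    rw [ancillas]
    omega
  rw [Matrix.mul_assoc, Matrix.mul_apply, sum_basis, Finset.mul_sum, map_sum]
  refine Finset.sum_congr rfl fun b hb => ?_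
  have hb' := Finset.mem_range.1 hb
  rw [accProj, Matrix.diagonal_mul, bit_toBasis hb', Matrix.conjTranspose_apply]
  by_cases h : digit 2 b 0 = 1
  · rw [if_pos h, if_pos (Fin.ext h), val_mul, val_conj, val_column ts _ hb', val_column ts _ hb',
      Polynomial.map_C, map_mul (starRingEnd ℂ), map_pow (starRingEnd ℂ), Complex.conj_ofReal,
      ← C_mul, one_mul]
    congr 1
    rw [← sqrt_two_mul_sqrt_two, mul_pow]
    simp only [starRingEnd_apply]
    ring
  · rw [if_neg h, if_neg fun h' => h (congrArg Fin.val h'), zero_mul, mul_zero, mul_zero, C_0,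
      val_nil]

section Primrec

open Primrec

variable {α : Type} [Primcodable α]

theorem primrec_digit {N x i : α → ℕ} (hN : Primrec N) (hx : Primrec x) (hi : Primrec i) :
    Primrec fun a => digit (N a) (x a) (i a) :=
  nat_mod.comp (nat_div.comp hx (primrec₂_pow.comp hN hi)) hN

theorem primrecPred_agree {n a b q r : α → ℕ} (hn : Primrec n) (ha : Primrec a) (hb : Primrec b)
    (hq : Primrec q) (hr : Primrec r) :
    PrimrecPred fun x => Agree (n x) (a x) (b x) (q x) (r x) := by
  have h : PrimrecRel fun (j : ℕ) (p : ℕ × ℕ × ℕ × ℕ) =>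
      j = p.2.2.1 ∨ j = p.2.2.2 ∨ digit 2 p.1 j = digit 2 p.2.1 j :=
    (Primrec.eq.comp fst (fst.comp (snd.comp (snd.comp snd)))).or
      ((Primrec.eq.comp fst (snd.comp (snd.comp (snd.comp snd)))).or
        (Primrec.eq.comp (primrec_digit (const 2) (fst.comp snd) fst)
          (primrec_digit (const 2) (fst.comp (snd.comp snd)) fst)))
  exact ((PrimrecRel.forall_mem_list h).comp (list_range.comp hn) (pair ha (pair hb (pair hq hr)))).of_eq
    fun x => by simp [Agree]

theorem primrec_gateEntry {t : α → ℕ × ℕ × ℕ} {n a b : α → ℕ} (ht : Primrec t) (hn : Primrec n)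
    (ha : Primrec a) (hb : Primrec b) : Primrec fun x => gateEntry (t x) (n x) (a x) (b x) := by
  have h1 : Primrec fun x => (t x).1 := fst.comp ht
  have h2 : Primrec fun x => (t x).2.1 - 1 := pred.comp (fst.comp (snd.comp ht))
  have h3 : Primrec fun x => (t x).2.2 - 1 := pred.comp (snd.comp (snd.comp ht))
  have d : ∀ {y q : α → ℕ}, Primrec y → Primrec q → Primrec fun x => digit 2 (y x) (q x) :=
    fun hy hq => primrec_digit (const 2) hy hq
  exact Primrec.ite (Primrec.eq.comp h1 (const 0))
    (Primrec.ite (primrecPred_agree hn ha hb h3 h3)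
      (Primrec.ite ((Primrec.eq.comp (d ha h3) (const 1)).and (Primrec.eq.comp (d hb h3) (const 1)))
        (const _) (const _)) (const _))
    (Primrec.ite (Primrec.eq.comp h1 (const 1))
      (Primrec.ite ((primrecPred_agree hn ha hb h3 h3).and (Primrec.eq.comp (d ha h3) (d hb h3)))
        (Primrec.ite (Primrec.eq.comp (d ha h3) (const 1)) (const _) (const _)) (const _))
      (Primrec.ite ((primrecPred_agree hn ha hb h2 h3).and
        ((Primrec.eq.comp (d ha h2) (d hb h2)).and (Primrec.eq.comp (d ha h3)
          (nat_mod.comp (nat_add.comp (d hb h2) (d hb h3)) (const 2))))) (const _) (const _)))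

theorem primrec_applyGate {n : α → ℕ} {v : α → List CycSum} {t : α → ℕ × ℕ × ℕ} (hn : Primrec n)
    (hv : Primrec v) (ht : Primrec t) : Primrec fun x => applyGate (n x) (v x) (t x) := by
  have hN : Primrec fun x => 2 ^ n x := primrec₂_pow.comp (const 2) hn
  have h : Primrec₂ fun (p : α × ℕ) (c : ℕ) =>
      mul (gateEntry (t p.1) (n p.1) p.2 c) ((v p.1).getD c []) :=
    primrec_mul.comp
      (primrec_gateEntry (ht.comp (fst.comp fst)) (hn.comp (fst.comp fst)) (snd.comp fst) snd)
      ((list_getD []).comp (hv.comp (fst.comp fst)) snd)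
  exact list_map (list_range.comp hN) (primrec_sum (hN.comp fst) h).to₂

theorem primrec_column {n : α → ℕ} {ts : α → List (ℕ × ℕ × ℕ)} {j : α → ℕ} (hn : Primrec n)
    (hts : Primrec ts) (hj : Primrec j) : Primrec fun x => column (n x) (ts x) (j x) := by
  have hN : Primrec fun x => 2 ^ n x := primrec₂_pow.comp (const 2) hn
  have h1 : Primrec fun p : α × ℕ =>
      if Agree (n p.1) p.2 (j p.1) (n p.1) (n p.1) then [((0, 0) : ℕ × ℕ)] else [] :=
    Primrec.ite (primrecPred_agree (hn.comp fst) snd (hj.comp fst) (hn.comp fst) (hn.comp fst))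
      (const _) (const _)
  exact list_foldl (h := fun x p => applyGate (n x) p.1 p.2) hts
    (list_map (list_range.comp hN) h1.to₂)
    (primrec_applyGate (hn.comp fst) (fst.comp snd) (snd.comp snd)).to₂

theorem primrec_numQubits {m : α → ℕ} {ts : α → List (ℕ × ℕ × ℕ)} (hm : Primrec m)
    (hts : Primrec ts) : Primrec fun x => numQubits (m x) (ts x) := by
  have hw : Primrec fun t => (gateOfTriple t).width := by
    have h1 : Primrec fun t : ℕ × ℕ × ℕ => t.2.1 - 1 + 1 := succ.comp (pred.comp (fst.comp snd))
    have h2 : Primrec fun t : ℕ × ℕ × ℕ => t.2.2 - 1 + 1 := succ.comp (pred.comp (snd.comp snd))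
    refine (Primrec.ite (Primrec.eq.comp fst (const 0)) h2
      (Primrec.ite (Primrec.eq.comp fst (const 1)) h2 (nat_max.comp h1 h2))).of_eq fun t => ?_
    unfold gateOfTriple
    split_ifs <;> rfl
  have h := nat_add.comp hm (nat_sub.comp (list_foldr (h := fun x p => max p.1 p.2)
    (list_map hts (hw.comp₂ Primrec₂.right)) (const 1) (nat_max.comp (fst.comp snd) (snd.comp snd)).to₂) hm)
  refine h.of_eq fun x => ?_
  simp [numQubits, ancillas, Function.comp_def]

theorem primrec_accEntry {m : α → ℕ} {ts : α → List (ℕ × ℕ × ℕ)} {i j : α → ℕ} (hm : Primrec m)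
    (hts : Primrec ts) (hi : Primrec i) (hj : Primrec j) :
    Primrec fun x => accEntry (m x) (ts x) (i x) (j x) := by
  have hn := primrec_numQubits hm hts
  have hc : ∀ {i : α → ℕ}, Primrec i → Primrec fun p : α × ℕ =>
      (column (numQubits (m p.1) (ts p.1)) (ts p.1) (i p.1)).getD p.2 [] := fun hi =>
    (list_getD []).comp ((primrec_column hn hts hi).comp fst) snd
  exact primrec_sum (primrec₂_pow.comp (const 2) hn)
    (Primrec.ite (Primrec.eq.comp (primrec_digit (const 2) snd (const 0)) (const 1))
      (primrec_mul.comp (primrec_conj.comp (hc hi)) (hc hj)) (const [])).to₂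

end Primrec

/-! ### Exact computation of characteristic polynomials -/

open Polynomial

/-- The sign of a permutation, extended by `0` to all maps: the product of the signs of
`f j - f i` over `i < j`. -/
def mapSign {N : ℕ} (R : Type*) [CommRing R] (f : Fin N → Fin N) : R :=
  ∏ i, ∏ j, if i < j then (if f i < f j then 1 else if f j < f i then -1 else 0) else 1

theorem mapSign_perm {N : ℕ} (R : Type*) [CommRing R] (σ : Equiv.Perm (Fin N)) :
    mapSign R σ = ((Equiv.Perm.sign σ : ℤˣ) : ℤ) := by
  rw [σ.sign_eq_prod_prod_Ioi, mapSign]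
  push_cast
  refine Finset.prod_congr rfl fun i _ => ?_
  rw [← Finset.prod_filter, Finset.filter_lt_eq_Ioi]
  refine Finset.prod_congr rfl fun j hj => ?_
  have hne : σ i ≠ σ j := σ.injective.ne (Finset.mem_Ioi.1 hj).ne
  rcases lt_or_gt_of_ne hne with h | h
  · simp [h]
  · simp [h, h.not_gt]

theorem mapSign_eq_zero {N : ℕ} (R : Type*) [CommRing R] {f : Fin N → Fin N}
    (hf : ¬ Function.Injective f) : mapSign R f = 0 := by
  obtain ⟨i, j, hij, hlt⟩ : ∃ i j, f i = f j ∧ i < j := by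
    simp only [Function.Injective, not_forall] at hf
    obtain ⟨i, j, hij, hne⟩ := hf
    rcases lt_or_gt_of_ne hne with h | h
    · exact ⟨i, j, hij, h⟩
    · exact ⟨j, i, hij.symm, h⟩
  refine Finset.prod_eq_zero (Finset.mem_univ i) (Finset.prod_eq_zero (Finset.mem_univ j) ?_)
  simp [hlt, hij]

/-- The Leibniz formula as a sum over all maps, which are numbered by the naturals below `N ^ N`
and need not be tested for bijectivity. -/
theorem det_eq_sum_map {N : ℕ} {R : Type*} [CommRing R] (A : Matrix (Fin N) (Fin N) R) :
    A.det = ∑ f : Fin N → Fin N, mapSign R f * ∏ i, A (f i) i := by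
  rw [Matrix.det_apply']
  refine Fintype.sum_of_injective (fun σ : Equiv.Perm (Fin N) => (σ : Fin N → Fin N))
    DFunLike.coe_injective _ _ (fun f hf => ?_) (fun σ => ?_)
  · rw [mapSign_eq_zero, zero_mul]
    intro hi
    exact hf ⟨Equiv.ofBijective f (Finite.injective_iff_bijective.1 hi), rfl⟩
  · rw [mapSign_perm]

open CycSum

/-- An entry of `c - 3 Q` for the acceptance operator `Q`, scaled by `2` for each gate. -/
def thresholdEntry (c m : ℕ) (ts : List (ℕ × ℕ × ℕ)) (i j : ℕ) : CycSum :=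
  (if i = j then CycSum.nat (c * 2 ^ ts.length) 0 else []) ++
    mul (CycSum.nat 3 4) (accEntry m ts i j)

/-- The sign of the map whose values are the digits of `f`. -/
def signSum (N f : ℕ) : CycSum :=
  CycSum.prod N fun i => CycSum.prod N fun j =>
    if i < j then
      if digit N f i < digit N f j then [(0, 0)]
      else if digit N f j < digit N f i then [(4, 0)] else []
    else [(0, 0)]

/-- The determinant of `X + s (c - 3 Q)` with the scaling factor `s` of `thresholdEntry`. The maps
in the Leibniz formula are numbered by `f`, whose digits in base `2 ^ m` are their values. -/
def charSum (c m : ℕ) (ts : List (ℕ × ℕ × ℕ)) : CycSum :=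
  CycSum.sum ((2 ^ m) ^ 2 ^ m) fun f => mul (signSum (2 ^ m) f) (CycSum.prod (2 ^ m) fun i =>
    (if digit (2 ^ m) f i = i then [(0, 1)] else []) ++
      thresholdEntry c m ts (digit (2 ^ m) f i) i)

theorem val_thresholdEntry (c m : ℕ) (ts : List (ℕ × ℕ × ℕ)) {w : List Bool}
    (hw : decodeCircuit w = some (ts.map gateOfTriple)) {i j : ℕ} (hi : i < 2 ^ m)
    (hj : j < 2 ^ m) :
    val (thresholdEntry c m ts i j) =
      C (2 ^ ts.length * ((if i = j then (c : ℂ) else 0) -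
        3 * accOp m w (toBasis m i) (toBasis m j))) := by
  have h : val (if i = j then CycSum.nat (c * 2 ^ ts.length) 0 else []) =
      C (2 ^ ts.length * (if i = j then (c : ℂ) else 0)) := by
    split_ifs
    · rw [val_nat]
      push_cast
      congr 1
      ring
    · simp
  rw [thresholdEntry, val_append, h, val_mul, val_nat, val_accEntry m ts hw hi hj, zeta_pow_four,
    ← C_mul, ← C_add]
  congr 1
  push_cast
  ring

theorem val_signSum (N : ℕ) (f : Fin N → Fin N) :
    val (signSum N (finFunctionFinEquiv f)) = mapSign ℂ[X] f := by
  have hd : ∀ i : Fin N, digit N (finFunctionFinEquiv f) i = f i := fun i =>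
    congrArg Fin.val (congrFun (finFunctionFinEquiv.symm_apply_apply f) i)
  rw [signSum, CycSum.val_prod, mapSign, Finset.prod_range]
  refine Finset.prod_congr rfl fun i _ => ?_
  rw [CycSum.val_prod, Finset.prod_range]
  refine Finset.prod_congr rfl fun j _ => ?_
  simp only [hd, Fin.val_fin_lt]
  split_ifs
  · exact val_one
  · rw [val_neg_one]; simp
  · rfl
  · exact val_one

/-- The roots of `charSum` are the eigenvalues of `3 Q - c`, up to a positive factor. -/
theorem val_charSum (c m : ℕ) (ts : List (ℕ × ℕ × ℕ)) {w : List Bool}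
    (hw : decodeCircuit w = some (ts.map gateOfTriple)) :
    val (charSum c m ts) =
      ((2 ^ ts.length : ℂ) • ((3 : ℂ) • accOp m w - (c : ℂ) • (1 : Op m))).charpoly := by
  rw [← Matrix.charpoly_reindex (finFunctionFinEquiv (m := 2) (n := m)), Matrix.charpoly,
    det_eq_sum_map, charSum, CycSum.val_sum, Finset.sum_range]
  refine (Fintype.sum_equiv finFunctionFinEquiv _ _ fun f => ?_).symm
  have hd : ∀ i : Fin (2 ^ m), digit (2 ^ m) (finFunctionFinEquiv f) i = f i := fun i =>
    congrArg Fin.val (congrFun (finFunctionFinEquiv.symm_apply_apply f) i)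
  rw [val_mul, val_signSum, CycSum.val_prod, Finset.prod_range]
  congr 1
  refine Finset.prod_congr rfl fun i _ => ?_
  rw [hd, val_append, val_thresholdEntry c m ts hw (Fin.is_lt _) (Fin.is_lt _),
    Matrix.charmatrix_apply, toBasis_eq (Fin.is_lt _), toBasis_eq (Fin.is_lt _)]
  simp only [Fin.eta, Matrix.reindex_apply, Matrix.submatrix_apply, Matrix.smul_apply,
    Matrix.sub_apply, Matrix.one_apply, Equiv.apply_eq_iff_eq, smul_eq_mul]
  by_cases h : f i = i
  · rw [h]
    simp only [Matrix.diagonal_apply_eq, if_true, val_cons, val_nil, add_zero, pow_zero,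
      monomial_one_one_eq_X, sub_eq_add_neg, ← C_neg]
    congr 2
    ring
  · rw [Matrix.diagonal_apply_ne _ h, if_neg (fun h' => h (Fin.ext h')),
      if_neg (fun h' => h (Fin.ext h')), if_neg h, val_nil, zero_sub, zero_add, ← C_neg]
    congr 1
    ring

section Primrec

open Primrec

variable {α : Type} [Primcodable α]

theorem primrec_thresholdEntry (c : ℕ) {m : α → ℕ} {ts : α → List (ℕ × ℕ × ℕ)} {i j : α → ℕ}
    (hm : Primrec m) (hts : Primrec ts) (hi : Primrec i) (hj : Primrec j) :
    Primrec fun x => thresholdEntry c (m x) (ts x) (i x) (j x) :=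
  list_append.comp
    (Primrec.ite (Primrec.eq.comp hi hj)
      (primrec_nat.comp (nat_mul.comp (const c) (primrec₂_pow.comp (const 2) (list_length.comp hts)))
        (const 0)) (const []))
    (primrec_mul.comp (const _) (primrec_accEntry hm hts hi hj))

theorem primrec_signSum {N f : α → ℕ} (hN : Primrec N) (hf : Primrec f) :
    Primrec fun x => signSum (N x) (f x) := by
  have h0 : Primrec fun p : (α × ℕ) × ℕ => p.1.1 := fst.comp fst
  have d1 : Primrec fun p : (α × ℕ) × ℕ => digit (N p.1.1) (f p.1.1) p.1.2 :=
    primrec_digit (hN.comp h0) (hf.comp h0) (snd.comp fst)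
  have d2 : Primrec fun p : (α × ℕ) × ℕ => digit (N p.1.1) (f p.1.1) p.2 :=
    primrec_digit (hN.comp h0) (hf.comp h0) snd
  have h : Primrec₂ fun (p : α × ℕ) (j : ℕ) =>
      if p.2 < j then
        if digit (N p.1) (f p.1) p.2 < digit (N p.1) (f p.1) j then [((0, 0) : ℕ × ℕ)]
        else if digit (N p.1) (f p.1) j < digit (N p.1) (f p.1) p.2 then [(4, 0)] else []
      else [(0, 0)] :=
    Primrec.ite (nat_lt.comp (snd.comp fst) snd)
      (Primrec.ite (nat_lt.comp d1 d2) (const [(0, 0)])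
        (Primrec.ite (nat_lt.comp d2 d1) (const [(4, 0)]) (const []))) (const [(0, 0)])
  exact primrec_prod hN (primrec_prod (hN.comp fst) h)

theorem primrec_charSum (c : ℕ) {m : α → ℕ} {ts : α → List (ℕ × ℕ × ℕ)} (hm : Primrec m)
    (hts : Primrec ts) : Primrec fun x => charSum c (m x) (ts x) := by
  have hN : Primrec fun x => 2 ^ m x := primrec₂_pow.comp (const 2) hm
  have h0 : Primrec fun p : (α × ℕ) × ℕ => p.1.1 := fst.comp fst
  have d : Primrec fun p : (α × ℕ) × ℕ => digit (2 ^ m p.1.1) p.1.2 p.2 :=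
    primrec_digit (hN.comp h0) (snd.comp fst) snd
  have h : Primrec₂ fun (p : α × ℕ) (i : ℕ) =>
      (if digit (2 ^ m p.1) p.2 i = i then [((0, 1) : ℕ × ℕ)] else []) ++
        thresholdEntry c (m p.1) (ts p.1) (digit (2 ^ m p.1) p.2 i) i :=
    list_append.comp (Primrec.ite (Primrec.eq.comp d snd) (const [(0, 1)]) (const []))
      (primrec_thresholdEntry c (hm.comp h0) (hts.comp h0) d snd)
  exact primrec_sum (primrec₂_pow.comp hN hN)
    (primrec_mul.comp (primrec_signSum (hN.comp fst) snd) (primrec_prod (hN.comp fst) h))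

end Primrec

/-! ### Signs of the roots of real-rooted polynomials -/

theorem coeff_prod_X_sub_C_nonneg {ι : Type*} (s : Finset ι) (β : ι → ℝ) (h : ∀ i ∈ s, β i ≤ 0)
    (k : ℕ) : 0 ≤ (∏ i ∈ s, (X - C (β i))).coeff k := by
  classical
  induction s using Finset.induction_on generalizing k with
  | empty => rw [Finset.prod_empty, coeff_one]; split_ifs <;> norm_num
  | insert a s ha ih =>
    rw [Finset.prod_insert ha, mul_comm]
    have ih' := ih fun i hi => h i (Finset.mem_insert_of_mem hi)
    have hb := h a (Finset.mem_insert_self a s)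
    cases k with
    | zero =>
      rw [mul_coeff_zero]
      simp only [coeff_sub, coeff_X_zero, coeff_C_zero, zero_sub]
      exact mul_nonneg (ih' 0) (by linarith)
    | succ k =>
      rw [coeff_mul_X_sub_C]
      nlinarith [ih' k, ih' (k + 1), mul_nonneg (ih' (k + 1)) (neg_nonneg.2 hb)]

theorem coeff_prod_X_sub_C_pos {ι : Type*} (s : Finset ι) (β : ι → ℝ) (h : ∀ i ∈ s, β i < 0)
    (k : ℕ) (hk : k ≤ s.card) : 0 < (∏ i ∈ s, (X - C (β i))).coeff k := by
  classical
  induction s using Finset.induction_on generalizing k with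
  | empty =>
    obtain rfl : k = 0 := by simpa using hk
    simp
  | insert a s ha ih =>
    rw [Finset.card_insert_of_notMem ha] at hk
    rw [Finset.prod_insert ha, mul_comm]
    have ih' := ih fun i hi => h i (Finset.mem_insert_of_mem hi)
    have hb := h a (Finset.mem_insert_self a s)
    cases k with
    | zero =>
      rw [mul_coeff_zero]
      simp only [coeff_sub, coeff_X_zero, coeff_C_zero, zero_sub]
      exact mul_pos (ih' 0 (Nat.zero_le _)) (by linarith)
    | succ k =>
      rw [coeff_mul_X_sub_C]
      have h1 := ih' k (by omega)
      have h2 := coeff_prod_X_sub_C_nonneg s β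
        (fun i hi => (h i (Finset.mem_insert_of_mem hi)).le) (k + 1)
      nlinarith [mul_nonneg h2 (neg_nonneg.2 hb.le)]

/-- A polynomial with nonnegative coefficients has no root at `x ≥ 0` unless all its terms vanish
there. -/
theorem eval_ne_zero_of_coeff_nonneg {p : ℝ[X]} (hp : ∀ k ≤ p.natDegree, 0 ≤ p.coeff k) {x : ℝ}
    (hx : 0 ≤ x) {k : ℕ} (hk : k ≤ p.natDegree) (hpos : 0 < p.coeff k * x ^ k) : p.eval x ≠ 0 := by
  rw [eval_eq_sum_range]
  refine (Finset.sum_pos' (fun i hi => ?_) ⟨k, ?_, hpos⟩).ne'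
  · exact mul_nonneg (hp i (Finset.mem_range_succ_iff.1 hi)) (pow_nonneg hx i)
  · exact Finset.mem_range_succ_iff.2 hk

variable {ι : Type*} [Fintype ι] (β : ι → ℝ)

theorem eval_prod_X_sub_C (i : ι) : (∏ i, (X - C (β i))).eval (β i) = 0 := by
  rw [eval_prod]
  exact Finset.prod_eq_zero (Finset.mem_univ i) (by simp)

theorem natDegree_prod_X_sub_C : (∏ i, (X - C (β i))).natDegree = Fintype.card ι := by
  simp [Finset.card_univ]

/-- All roots are nonpositive if and only if all coefficients are nonnegative. -/
theorem forall_nonpos_iff :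
    (∀ i, β i ≤ 0) ↔ ∀ k ≤ Fintype.card ι, 0 ≤ (∏ i, (X - C (β i))).coeff k := by
  refine ⟨fun h k _ => coeff_prod_X_sub_C_nonneg _ β (fun i _ => h i) k, fun h i => ?_⟩
  by_contra! hi
  rw [← natDegree_prod_X_sub_C β] at h
  refine eval_ne_zero_of_coeff_nonneg h hi.le le_rfl ?_ (eval_prod_X_sub_C β i)
  have hm : (∏ i, (X - C (β i))).Monic := monic_prod_of_monic _ _ fun i _ => monic_X_sub_C _
  rw [hm.coeff_natDegree]
  positivity

/-- All roots are negative if and only if all coefficients are positive. -/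
theorem forall_neg_iff :
    (∀ i, β i < 0) ↔ ∀ k ≤ Fintype.card ι, 0 < (∏ i, (X - C (β i))).coeff k := by
  refine ⟨fun h k hk => coeff_prod_X_sub_C_pos _ β (fun i _ => h i) k hk, fun h i => ?_⟩
  by_contra! hi
  rw [← natDegree_prod_X_sub_C β] at h
  refine eval_ne_zero_of_coeff_nonneg (fun k hk => (h k hk).le) hi (Nat.zero_le _) ?_
    (eval_prod_X_sub_C β i)
  rw [pow_zero, mul_one]
  exact h 0 (Nat.zero_le _)

/-! ### The acceptance operator and its largest eigenvalue -/

section Spectral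

variable {ι : Type*} [Fintype ι] [DecidableEq ι] {A : Matrix ι ι ℂ}

open scoped Matrix
open Polynomial

theorem hasEigenvalue_iff_mem_range (hA : A.IsHermitian) (r : ℝ) :
    Module.End.HasEigenvalue (Matrix.toLin' A) (r : ℂ) ↔ r ∈ Set.range hA.eigenvalues := by
  rw [Module.End.hasEigenvalue_iff_mem_spectrum, Matrix.spectrum_toLin', hA.spectrum_eq_image_range]
  exact Complex.ofReal_injective.mem_set_image

/-- The quadratic form of a Hermitian matrix in coordinates with respect to an eigenbasis. -/
theorem exists_re_dotProduct_eq_sum (hA : A.IsHermitian) (ψ : ι → ℂ) :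
    ∃ φ : ι → ℂ, ∑ i, ‖φ i‖ ^ 2 = ∑ i, ‖ψ i‖ ^ 2 ∧
      (star ψ ⬝ᵥ (A *ᵥ ψ)).re = ∑ i, hA.eigenvalues i * ‖φ i‖ ^ 2 := by
  have hnorm : ∀ z : ℂ, star z * z = ((‖z‖ ^ 2 : ℝ) : ℂ) := fun z => by
    rw [mul_comm]; simpa using Complex.mul_conj' z
  set U : Matrix ι ι ℂ := (hA.eigenvectorUnitary : Matrix ι ι ℂ)
  have hUU : U * star U = 1 := Unitary.coe_mul_star_self hA.eigenvectorUnitary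
  have hconj : ∀ B : Matrix ι ι ℂ, star ψ ⬝ᵥ ((U * B * star U) *ᵥ ψ) =
      star (star U *ᵥ ψ) ⬝ᵥ (B *ᵥ (star U *ᵥ ψ)) := by
    intro B
    rw [Matrix.star_mulVec, Matrix.star_eq_conjTranspose, Matrix.conjTranspose_conjTranspose,
      ← Matrix.dotProduct_mulVec, Matrix.mulVec_mulVec, Matrix.mulVec_mulVec, Matrix.mul_assoc]
  refine ⟨star U *ᵥ ψ, ?_, ?_⟩
  · have h := hconj 1
    rw [Matrix.mul_one, hUU, Matrix.one_mulVec, Matrix.one_mulVec] at h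
    simp only [dotProduct, Pi.star_apply, hnorm] at h
    exact_mod_cast h.symm
  · have h := hconj (Matrix.diagonal (RCLike.ofReal ∘ hA.eigenvalues))
    have e : A = U * Matrix.diagonal (RCLike.ofReal ∘ hA.eigenvalues) * star U := by
      conv_lhs => rw [hA.spectral_theorem, Unitary.conjStarAlgAut_apply]
    rw [← e] at h
    rw [h, dotProduct, Complex.re_sum]
    refine Finset.sum_congr rfl fun i _ => ?_
    rw [Matrix.mulVec_diagonal, Pi.star_apply, mul_left_comm, hnorm]
    simp only [Function.comp_apply, Complex.coe_algebraMap]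
    rw [← Complex.ofReal_mul, Complex.ofReal_re]

/-- The characteristic polynomial of an affine function of a Hermitian matrix is a product of real
linear factors. -/
theorem charpoly_smul_sub (hA : A.IsHermitian) (s a b : ℝ) :
    ((s : ℂ) • ((a : ℂ) • A - (b : ℂ) • (1 : Matrix ι ι ℂ))).charpoly =
      (∏ i, (X - C (s * (a * hA.eigenvalues i - b)))).map Complex.ofRealHom := by
  have e : (s : ℂ) • ((a : ℂ) • A - (b : ℂ) • (1 : Matrix ι ι ℂ)) =
      Unitary.conjStarAlgAut ℂ _ hA.eigenvectorUnitary (Matrix.diagonal fun i =>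
        ((s * (a * hA.eigenvalues i - b) : ℝ) : ℂ)) := by
    have hd : (Matrix.diagonal fun i => ((s * (a * hA.eigenvalues i - b) : ℝ) : ℂ)) =
        (s : ℂ) • ((a : ℂ) • Matrix.diagonal (RCLike.ofReal ∘ hA.eigenvalues) -
          (b : ℂ) • (1 : Matrix ι ι ℂ)) := by
      ext i j
      by_cases h : i = j
      · subst h; simp
      · simp [h]
    conv_lhs => rw [hA.spectral_theorem]
    rw [hd, map_smul, map_sub, map_smul, map_smul, map_one]
  rw [e, Unitary.conjStarAlgAut_apply, Matrix.charpoly_mul_comm, ← mul_assoc,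
    Unitary.coe_star_mul_self, one_mul, Matrix.charpoly_diagonal, Polynomial.map_prod]
  simp

end Spectral

section Acceptance

open scoped Matrix

theorem isHermitian_accOp (m : ℕ) (w : List Bool) : (accOp m w).IsHermitian := by
  rw [accOp]
  split
  · exact Matrix.isHermitian_zero
  · refine Matrix.IsHermitian.submatrix ?_ _
    refine Matrix.isHermitian_conjTranspose_mul_mul _ ?_
    exact Matrix.isHermitian_diagonal_of_self_adjoint _ (by
      ext a
      simp only [Pi.star_apply]
      split_ifs <;> simp)

/-- A sum of terms that vanish unless the ancillas are `0` runs over the witness basis states. -/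
theorem sum_append_zero {M : Type*} [AddCommMonoid M] {m k : ℕ} (f : Basis (m + k) → M)
    (hf : ∀ a, ¬ (∀ j : Fin k, a (Fin.natAdd m j) = 0) → f a = 0) :
    ∑ a, f a = ∑ y : Basis m, f (Fin.append y 0) := by
  refine (Fintype.sum_of_injective (fun y : Basis m => (Fin.append y 0 : Basis (m + k)))
    (fun y y' h => ?_) _ _ (fun a ha => hf a fun h => ha ?_) fun _ => rfl).symm
  · funext i
    simpa using congrFun h (Fin.castAdd k i)
  · refine ⟨fun i => a (Fin.castAdd k i), ?_⟩
    funext j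
    refine Fin.addCases (fun j => ?_) (fun j => ?_) j
    · simp
    · simp [h j]

theorem withZeros_append {m k : ℕ} (ψ : Basis m → ℂ) (y : Basis m) :
    withZeros k ψ (Fin.append y 0) = ψ y := by
  simp [withZeros]

/-- The acceptance probability is the quadratic form of the acceptance operator. -/
theorem accProb_eq {m : ℕ} (w : List Bool) (ψ : Basis m → ℂ) :
    accProb w ψ = (star ψ ⬝ᵥ (accOp m w *ᵥ ψ)).re := by
  rw [accProb, accOp]
  split
  · simp
  · rename_i C _
    simp only
    congr 1
    have hz : ∀ a : Basis (m + ancillas m C), ¬ (∀ j, a (Fin.natAdd m j) = 0) →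
        withZeros (ancillas m C) ψ a = 0 := fun a ha => if_neg ha
    rw [dotProduct, sum_append_zero _ fun a ha => by rw [Pi.star_apply, hz a ha, star_zero, zero_mul]]
    refine Finset.sum_congr rfl fun y _ => ?_
    rw [Pi.star_apply, withZeros_append, Matrix.mulVec, dotProduct,
      sum_append_zero _ fun a ha => by rw [hz a ha, mul_zero]]
    congr 1
    refine Finset.sum_congr rfl fun y' _ => ?_
    rw [withZeros_append]
    rfl

theorem accProb_ket {m : ℕ} (w : List Bool) (y : Basis m) :
    accProb w (ket y) = (accOp m w y y).re := by
  rw [accProb_eq, ket, Matrix.mulVec_single_one]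
  have : star (Pi.single y (1 : ℂ)) = (Pi.single y 1 : Basis m → ℂ) := by
    ext a; by_cases h : a = y
    · subst h; simp
    · simp [h]
  rw [this, single_one_dotProduct]
  rfl

/-- The largest eigenvalue of the acceptance operator. -/
noncomputable def maxEigenvalue (m : ℕ) (w : List Bool) : ℝ :=
  Finset.univ.sup' Finset.univ_nonempty (isHermitian_accOp m w).eigenvalues

theorem maxEigenvalue_le_iff (m : ℕ) (w : List Bool) (c : ℝ) :
    maxEigenvalue m w ≤ c ↔ ∀ i, (isHermitian_accOp m w).eigenvalues i ≤ c := by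
  simp [maxEigenvalue]

theorem maxEigenvalue_lt_iff (m : ℕ) (w : List Bool) (c : ℝ) :
    maxEigenvalue m w < c ↔ ∀ i, (isHermitian_accOp m w).eigenvalues i < c := by
  simp [maxEigenvalue]

theorem exists_eigenvalues_eq (m : ℕ) (w : List Bool) :
    ∃ i, (isHermitian_accOp m w).eigenvalues i = maxEigenvalue m w := by
  obtain ⟨i, -, hi⟩ := Finset.exists_mem_eq_sup' Finset.univ_nonempty
    (isHermitian_accOp m w).eigenvalues
  exact ⟨i, hi.symm⟩

theorem isGreatest_maxEigenvalue (m : ℕ) (w : List Bool) :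
    IsGreatest {r : ℝ | Module.End.HasEigenvalue (Matrix.toLin' (accOp m w)) (r : ℂ)}
      (maxEigenvalue m w) := by
  refine ⟨(hasEigenvalue_iff_mem_range (isHermitian_accOp m w) _).2 (exists_eigenvalues_eq m w), ?_⟩
  intro r hr
  obtain ⟨i, rfl⟩ := (hasEigenvalue_iff_mem_range (isHermitian_accOp m w) r).1 hr
  exact (maxEigenvalue_le_iff m w _).1 le_rfl i

theorem accProb_le_maxEigenvalue {m : ℕ} (w : List Bool) {ψ : Basis m → ℂ} (hψ : IsState ψ) :
    accProb w ψ ≤ maxEigenvalue m w := by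
  obtain ⟨φ, h1, h2⟩ := exists_re_dotProduct_eq_sum (isHermitian_accOp m w) ψ
  rw [accProb_eq, h2]
  calc _ ≤ ∑ i, maxEigenvalue m w * ‖φ i‖ ^ 2 := Finset.sum_le_sum fun i _ =>
        mul_le_mul_of_nonneg_right ((maxEigenvalue_le_iff m w _).1 le_rfl i) (by positivity)
    _ = maxEigenvalue m w := by rw [← Finset.mul_sum, h1, hψ, mul_one]

theorem exists_isState_accProb_eq (m : ℕ) (w : List Bool) :
    ∃ ψ : Basis m → ℂ, IsState ψ ∧ accProb w ψ = maxEigenvalue m w := by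
  obtain ⟨i, hi⟩ := exists_eigenvalues_eq m w
  refine ⟨(isHermitian_accOp m w).eigenvectorBasis i, ?_, ?_⟩
  · have h := (isHermitian_accOp m w).eigenvectorBasis.orthonormal.1 i
    have := EuclideanSpace.norm_sq_eq ((isHermitian_accOp m w).eigenvectorBasis i)
    rw [h, one_pow] at this
    exact this.symm
  · rw [accProb_eq, ← hi, (isHermitian_accOp m w).eigenvalues_eq]
    rfl

/-- The largest acceptance probability of a classical witness. -/
noncomputable def maxKetProb (m : ℕ) (w : List Bool) : ℝ :=
  Finset.univ.sup' Finset.univ_nonempty fun y : Basis m => accProb w (ket y)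

theorem isGreatest_maxKetProb (m : ℕ) (w : List Bool) :
    IsGreatest (Set.range fun y : Basis m => accProb w (ket y)) (maxKetProb m w) := by
  obtain ⟨y, -, hy⟩ := Finset.exists_mem_eq_sup' Finset.univ_nonempty
    fun y : Basis m => accProb w (ket y)
  refine ⟨⟨y, hy.symm⟩, ?_⟩
  rintro _ ⟨y, rfl⟩
  exact Finset.le_sup' (fun y : Basis m => accProb w (ket y)) (Finset.mem_univ y)

end Acceptance

/-! ### Deciding the thresholds -/

open CycSum

theorem forall_basis_iff {m : ℕ} (p : Basis m → Prop) :
    (∀ y, p y) ↔ ∀ i < 2 ^ m, p (toBasis m i) := by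
  refine ⟨fun h i _ => h _, fun h y => ?_⟩
  have := h (finFunctionFinEquiv y) (Fin.is_lt _)
  rw [toBasis_eq (Fin.is_lt _)] at this
  have e : finFunctionFinEquiv.symm ⟨(finFunctionFinEquiv y : ℕ), Fin.is_lt _⟩ = y :=
    finFunctionFinEquiv.symm_apply_apply y
  rwa [e] at this

theorem re_val_thresholdEntry (c m : ℕ) (ts : List (ℕ × ℕ × ℕ)) {w : List Bool}
    (hw : decodeCircuit w = some (ts.map gateOfTriple)) {i : ℕ} (hi : i < 2 ^ m) :
    ((val (thresholdEntry c m ts i i)).coeff 0).re =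
      2 ^ ts.length * (c - 3 * accProb w (ket (toBasis m i))) := by
  rw [val_thresholdEntry c m ts hw hi hi, if_pos rfl, Polynomial.coeff_C_zero, accProb_ket]
  have e : (2 : ℂ) ^ ts.length = ((2 ^ ts.length : ℝ) : ℂ) := by push_cast; rfl
  rw [e, Complex.re_ofReal_mul]
  simp

theorem re_val_charSum (c m : ℕ) (ts : List (ℕ × ℕ × ℕ)) {w : List Bool}
    (hw : decodeCircuit w = some (ts.map gateOfTriple)) (k : ℕ) :
    ((val (charSum c m ts)).coeff k).re = (∏ i, (Polynomial.X - Polynomial.C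
      (2 ^ ts.length * (3 * (isHermitian_accOp m w).eigenvalues i - c)))).coeff k := by
  have h := charpoly_smul_sub (isHermitian_accOp m w) (2 ^ ts.length) 3 c
  push_cast at h
  rw [val_charSum c m ts hw, h, Polynomial.coeff_map]
  rfl

theorem accOp_of_not_isCircuitWord {w : List Bool} (h : ¬ IsCircuitWord w) (m : ℕ) :
    accOp m w = 0 := by
  rw [accOp, decodeCircuit_of_not_isCircuitWord h]

/-- The bound `c / 3` for classical witnesses is a sign condition on the diagonal of `c - 3 Q`. -/
theorem maxKetProb_le_third_iff (m c : ℕ) (w : List Bool) :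
    maxKetProb m w ≤ c / 3 ↔
      ¬ IsCircuitWord w ∨ ∀ i < 2 ^ m, NonnegAt (thresholdEntry c m (parse w) i i) 0 := by
  rw [maxKetProb, Finset.sup'_le_iff]
  simp only [Finset.mem_univ, true_imp_iff]
  by_cases h : IsCircuitWord w
  · have hw := decodeCircuit_of_isCircuitWord h
    simp only [h, not_true_eq_false, false_or]
    rw [forall_basis_iff]
    refine forall₂_congr fun i hi => ?_
    rw [nonnegAt_iff, re_val_thresholdEntry c m _ hw hi, mul_nonneg_iff_of_pos_left (by positivity)]
    constructor <;> intro h <;> linarith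
  · simp only [h, not_false_eq_true, true_or, iff_true]
    intro y
    rw [accProb_ket, accOp_of_not_isCircuitWord h]
    simp
    positivity

theorem maxKetProb_lt_third_iff (m c : ℕ) (hc : 0 < c) (w : List Bool) :
    maxKetProb m w < c / 3 ↔
      ¬ IsCircuitWord w ∨ ∀ i < 2 ^ m, PosAt (thresholdEntry c m (parse w) i i) 0 := by
  rw [maxKetProb, Finset.sup'_lt_iff]
  simp only [Finset.mem_univ, true_imp_iff]
  by_cases h : IsCircuitWord w
  · have hw := decodeCircuit_of_isCircuitWord h
    simp only [h, not_true_eq_false, false_or]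
    rw [forall_basis_iff]
    refine forall₂_congr fun i hi => ?_
    rw [posAt_iff, re_val_thresholdEntry c m _ hw hi, mul_pos_iff_of_pos_left (by positivity)]
    constructor <;> intro h <;> linarith
  · simp only [h, not_false_eq_true, true_or, iff_true]
    intro y
    rw [accProb_ket, accOp_of_not_isCircuitWord h]
    simp
    positivity

theorem card_basis (m : ℕ) : Fintype.card (Basis m) = 2 ^ m := by simp

theorem eigenvalues_of_not_isCircuitWord {w : List Bool} (h : ¬ IsCircuitWord w) (m : ℕ)
    (i : Basis m) : (isHermitian_accOp m w).eigenvalues i = 0 :=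
  congrFun ((isHermitian_accOp m w).eigenvalues_eq_zero_iff.2 (accOp_of_not_isCircuitWord h m)) i

/-- The bound `c / 3` for the largest eigenvalue is a sign condition on the coefficients of the
real-rooted polynomial `charSum`; no eigenvalue has to be computed. -/
theorem maxEigenvalue_le_third_iff (m c : ℕ) (w : List Bool) :
    maxEigenvalue m w ≤ c / 3 ↔
      ¬ IsCircuitWord w ∨ ∀ k < 2 ^ m + 1, NonnegAt (charSum c m (parse w)) k := by
  rw [maxEigenvalue_le_iff]
  by_cases h : IsCircuitWord w
  · have hw := decodeCircuit_of_isCircuitWord h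
    simp only [h, not_true_eq_false, false_or, nonnegAt_iff, re_val_charSum c m _ hw,
      Nat.lt_succ_iff]
    rw [← card_basis, ← forall_nonpos_iff]
    refine forall_congr' fun i => ?_
    rw [← neg_nonneg, ← mul_neg, mul_nonneg_iff_of_pos_left (by positivity)]
    constructor <;> intro h <;> linarith
  · simp only [h, not_false_eq_true, true_or, iff_true]
    intro i
    rw [eigenvalues_of_not_isCircuitWord h]
    positivity

theorem maxEigenvalue_lt_third_iff (m c : ℕ) (hc : 0 < c) (w : List Bool) :
    maxEigenvalue m w < c / 3 ↔
      ¬ IsCircuitWord w ∨ ∀ k < 2 ^ m + 1, PosAt (charSum c m (parse w)) k := by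
  rw [maxEigenvalue_lt_iff]
  by_cases h : IsCircuitWord w
  · have hw := decodeCircuit_of_isCircuitWord h
    simp only [h, not_true_eq_false, false_or, posAt_iff, re_val_charSum c m _ hw,
      Nat.lt_succ_iff]
    rw [← card_basis, ← forall_neg_iff]
    refine forall_congr' fun i => ?_
    rw [← neg_pos, ← mul_neg, mul_pos_iff_of_pos_left (by positivity)]
    constructor <;> intro h <;> linarith
  · simp only [h, not_false_eq_true, true_or, iff_true]
    intro i
    rw [eigenvalues_of_not_isCircuitWord h]
    positivity

section Primrec

open Primrec

variable {α : Type} [Primcodable α] {m : α → ℕ} {w : α → List Bool}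

theorem primrecPred_forall_lt {n : α → ℕ} {p : α → ℕ → Prop} (hn : Primrec n)
    (hp : PrimrecPred fun q : α × ℕ => p q.1 q.2) : PrimrecPred fun a => ∀ i < n a, p a i := by
  have h : PrimrecRel fun (i : ℕ) (a : α) => p a i := hp.comp (pair snd fst)
  exact ((PrimrecRel.forall_mem_list h).comp (list_range.comp hn) Primrec.id).of_eq
    fun a => by simp

theorem primrecPred_maxKetProb_le (c : ℕ) (hm : Primrec m) (hw : Primrec w) :
    PrimrecPred fun x => maxKetProb (m x) (w x) ≤ c / 3 := by
  simp only [maxKetProb_le_third_iff]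
  exact (primrecPred_isCircuitWord.comp hw).not.or
    (primrecPred_forall_lt (primrec₂_pow.comp (const 2) hm)
      (primrecPred_nonnegAt (primrec_thresholdEntry c (hm.comp fst)
        (primrec_parse.comp (hw.comp fst)) snd snd) (const 0)))

theorem primrecPred_maxKetProb_lt (c : ℕ) (hc : 0 < c) (hm : Primrec m) (hw : Primrec w) :
    PrimrecPred fun x => maxKetProb (m x) (w x) < c / 3 := by
  simp only [maxKetProb_lt_third_iff _ c hc]
  exact (primrecPred_isCircuitWord.comp hw).not.or
    (primrecPred_forall_lt (primrec₂_pow.comp (const 2) hm)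
      (primrecPred_posAt (primrec_thresholdEntry c (hm.comp fst)
        (primrec_parse.comp (hw.comp fst)) snd snd) (const 0)))

theorem primrecPred_maxEigenvalue_le (c : ℕ) (hm : Primrec m) (hw : Primrec w) :
    PrimrecPred fun x => maxEigenvalue (m x) (w x) ≤ c / 3 := by
  simp only [maxEigenvalue_le_third_iff]
  exact (primrecPred_isCircuitWord.comp hw).not.or
    (primrecPred_forall_lt (succ.comp (primrec₂_pow.comp (const 2) hm))
      (primrecPred_nonnegAt (primrec_charSum c (hm.comp fst)
        (primrec_parse.comp (hw.comp fst))) snd))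

theorem primrecPred_maxEigenvalue_lt (c : ℕ) (hc : 0 < c) (hm : Primrec m) (hw : Primrec w) :
    PrimrecPred fun x => maxEigenvalue (m x) (w x) < c / 3 := by
  simp only [maxEigenvalue_lt_third_iff _ c hc]
  exact (primrecPred_isCircuitWord.comp hw).not.or
    (primrecPred_forall_lt (succ.comp (primrec₂_pow.comp (const 2) hm))
      (primrecPred_posAt (primrec_charSum c (hm.comp fst)
        (primrec_parse.comp (hw.comp fst))) snd))

end Primrec

/-! ### Extremal problems -/

/-- If the problems decided are those on which `P` respects the thresholds, then the threshold
problem of `P` is the extremal one; it is totally decidable if comparing `P` with the thresholds is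
primitive recursive. -/
theorem exists_extremalProblem (P : List Bool → ℝ) (decides : PromiseProblem → Prop)
    (h : ∀ B, decides B ↔ (∀ x ∈ B.yes, 2 / 3 ≤ P x) ∧ ∀ x ∈ B.no, P x ≤ 1 / 3)
    (hle : PrimrecPred fun x => P x ≤ 1 / 3) (hlt : PrimrecPred fun x => P x < 2 / 3) :
    ∃ A, IsExtremalProblem decides A ∧ TotallyDecidable A ∧ IsThresholdProblem P A := by
  let A : PromiseProblem := ⟨{x | 2 / 3 ≤ P x}, {x | P x ≤ 1 / 3}, by
    rw [Set.disjoint_left]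
    intro x hx hx'
    simp only [Set.mem_ofPred_eq] at hx hx'
    linarith⟩
  refine ⟨A, ⟨(h A).2 ⟨fun x hx => hx, fun x hx => hx⟩, fun B hB => ?_⟩, ?_, rfl, rfl⟩
  · exact ⟨fun x hx => ((h B).1 hB).1 x hx, fun x hx => ((h B).1 hB).2 x hx⟩
  · exact totallyDecidable_of_primrecPred A (hlt.not.of_eq fun x => not_lt) hle

/-- Without witness qubits, the only classical witness is the empty one. -/
theorem BQPMachine.pAcc_eq (V : BQPMachine) (x : List Bool) :
    V.pAcc x = maxKetProb 0 (V.code x) := by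
  obtain ⟨y, hy⟩ := (isGreatest_maxKetProb 0 (V.code x)).1
  rw [← hy, Subsingleton.elim y 0]
  rfl

/-- The number of witness qubits and the circuit are read off the output: the first `0` ends the
unary representation of `m`. -/
theorem VerifierMachine.primrec (V : VerifierMachine) :
    (Primrec fun x : List Bool => V.m x.length) ∧ Primrec V.code := by
  open Primrec in
  have h := V.polyTime.primrec V.outputs
  have hidx : Primrec fun l : List Bool => l.findIdx fun b => !b :=
    list_findIdx Primrec.id (Primrec.not.comp snd).to₂
  have e : ∀ (k : ℕ) (l : List Bool),
      (List.replicate k true ++ false :: l).findIdx (fun b => !b) = k := by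
    intro k l
    induction k with
    | zero => rfl
    | succ k ih => rw [List.replicate_succ, List.cons_append, List.findIdx_cons, ih]; rfl
  refine ⟨(hidx.comp h).of_eq fun x => e _ _,
    (list_drop.comp (succ.comp (hidx.comp h)) h).of_eq fun x => ?_⟩
  rw [e]
  simp [List.drop_append]

end TotalDec

theorem mainTheorem7 :
    (∀ V : TotalDec.BQPMachine, ∃ A : TotalDec.PromiseProblem,
      TotalDec.IsExtremalProblem V.Decides A ∧ TotalDec.TotallyDecidable A ∧
        TotalDec.IsThresholdProblem V.pAcc A) ∧
    (∀ V : TotalDec.VerifierMachine, ∃ A : TotalDec.PromiseProblem,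
      TotalDec.IsExtremalProblem V.QCMADecides A ∧ TotalDec.TotallyDecidable A ∧
        ∃ P : List Bool → ℝ,
          (∀ x, IsGreatest (Set.range fun y => V.pAcc x (TotalDec.ket y)) (P x)) ∧
            TotalDec.IsThresholdProblem P A) ∧
    (∀ V : TotalDec.VerifierMachine, ∃ A : TotalDec.PromiseProblem,
      TotalDec.IsExtremalProblem V.QMADecides A ∧ TotalDec.TotallyDecidable A ∧
        ∃ P : List Bool → ℝ,
          (∀ x, IsGreatest
            {r : ℝ | Module.End.HasEigenvalue (Matrix.toLin' (V.Q x)) (r : ℂ)} (P x)) ∧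
            TotalDec.IsThresholdProblem P A) := by
  open TotalDec in
  refine ⟨fun V => ?_, fun V => ?_, fun V => ?_⟩
  · have hw := V.polyTime.primrec V.outputs
    have hle := primrecPred_maxKetProb_le 1 (Primrec.const 0) hw
    have hlt := primrecPred_maxKetProb_lt 2 two_pos (Primrec.const 0) hw
    simp only [← V.pAcc_eq, Nat.cast_one, Nat.cast_ofNat] at hle hlt
    exact exists_extremalProblem V.pAcc V.Decides (fun B => Iff.rfl) hle hlt
  · obtain ⟨hm, hw⟩ := V.primrec
    have hle := primrecPred_maxKetProb_le 1 hm hw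
    have hlt := primrecPred_maxKetProb_lt 2 two_pos hm hw
    simp only [Nat.cast_one, Nat.cast_ofNat] at hle hlt
    have hdec : ∀ B, V.QCMADecides B ↔
        (∀ x ∈ B.yes, 2 / 3 ≤ maxKetProb (V.m x.length) (V.code x)) ∧
          ∀ x ∈ B.no, maxKetProb (V.m x.length) (V.code x) ≤ 1 / 3 := by
      intro B
      refine and_congr (forall₂_congr fun x _ => ⟨?_, fun h => ?_⟩)
        (forall₂_congr fun x _ => ⟨fun h => ?_, fun h y => ?_⟩)
      · rintro ⟨y, hy⟩
        exact hy.trans ((isGreatest_maxKetProb _ _).2 ⟨y, rfl⟩)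
      · obtain ⟨y, hy⟩ := (isGreatest_maxKetProb (V.m x.length) (V.code x)).1
        exact ⟨y, h.trans hy.ge⟩
      · obtain ⟨y, hy⟩ := (isGreatest_maxKetProb (V.m x.length) (V.code x)).1
        exact hy.ge.trans (h y)
      · exact ((isGreatest_maxKetProb _ _).2 ⟨y, rfl⟩).trans h
    obtain ⟨A, h1, h2, h3⟩ := exists_extremalProblem _ V.QCMADecides hdec hle hlt
    exact ⟨A, h1, h2, _, fun x => isGreatest_maxKetProb _ _, h3⟩
  · obtain ⟨hm, hw⟩ := V.primrec
    have hle := primrecPred_maxEigenvalue_le 1 hm hw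
    have hlt := primrecPred_maxEigenvalue_lt 2 two_pos hm hw
    simp only [Nat.cast_one, Nat.cast_ofNat] at hle hlt
    have hdec : ∀ B, V.QMADecides B ↔
        (∀ x ∈ B.yes, 2 / 3 ≤ maxEigenvalue (V.m x.length) (V.code x)) ∧
          ∀ x ∈ B.no, maxEigenvalue (V.m x.length) (V.code x) ≤ 1 / 3 := by
      intro B
      refine and_congr (forall₂_congr fun x _ => ⟨?_, fun h => ?_⟩)
        (forall₂_congr fun x _ => ⟨fun h => ?_, fun h ψ hψ => ?_⟩)
      · rintro ⟨ψ, hψ, h⟩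
        exact h.trans (accProb_le_maxEigenvalue _ hψ)
      · obtain ⟨ψ, hψ, e⟩ := exists_isState_accProb_eq (V.m x.length) (V.code x)
        exact ⟨ψ, hψ, h.trans e.ge⟩
      · obtain ⟨ψ, hψ, e⟩ := exists_isState_accProb_eq (V.m x.length) (V.code x)
        exact e.ge.trans (h ψ hψ)
      · exact (accProb_le_maxEigenvalue _ hψ).trans h
    obtain ⟨A, h1, h2, h3⟩ := exists_extremalProblem _ V.QMADecides hdec hle hlt
    exact ⟨A, h1, h2, _, fun x => isGreatest_maxEigenvalue _ _, h3⟩
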